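/- **Setting.** For an operator $A$ on $n$ qubits write $A=\sum_{\sigma\in\{0,1,2,3\}^n}\widehat A(\sigma)P_\sigma$ in the basis of Pauli strings; $\deg(A)$ is the maximum of $|\{i:\sigma_i\ne 0\}|$ over $\sigma$ with $\widehat A(\sigma)\neq 0$ (and $\deg 0=0$), and $\deg_\varepsilon(A)=\min\{\deg(B):\|A-B\|\le\varepsilon\}$, where $\|\cdot\|$ is the spectral norm. For a pure state $|\varphi\rangle$ write $\varphi=|\varphi\rangle\langle\varphi|$. A depth-$d$ QAC circuit on $N$ qubits is a unitary $U=L_dM_d\cdots L_1M_1L_0$, where each $L_i$ is a tensor product of single-qubit unitaries and each $M_i$ is a product of multi-qubit gates $CZ=I-2|1\cdots1\rangle\langle1\cdots1|$ on pairwise disjoint sets of qubits. A QAC circuit $U$ on $n+a$ qubits synthesizes the $n$-qubit pure state $\varphi$ with $a$ ancillae and fidelity $1-\delta$ (where $\delta\ge 0$) if $\sqrt{\langle\varphi|\rho|\varphi\rangle}\ge 1-\delta$, where $\rho=\mathrm{Tr}_{n+1,\dots,n+a}\big[U|0^{n+a}\rangle\langle 0^{n+a}|U^\dagger\big]$. For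 $n\ge1$, the cat state is $\frac1{\sqrt2}(|0^n\rangle+|1^n\rangle)$, and an $n$-nekomata on $n+m$ qubits is a state $\frac{1}{\sqrt2}(|0^n,\psi_0\rangle+|1^n,\psi_1\rangle)$ with $\psi_0,\psi_1$ arbitrary $m$-qubit pure states. A family $(\psi_n)_n$, where $\psi_n$ is a pure state on $q(n)$ qubits, is in $\mathrm{stateQLC}^0[\delta]$ if for all $n\ge 1$ the state $\psi_n$ is synthesized with fidelity $1-\delta$ by a QAC circuit of depth $O(1)$ acting on $O(n)$ qubits in total (for $q(n)=n$: with $O(n)$ ancillae). **Theorem.** (1) There are absolute constants $C,c>0$ and $k\in\mathbb N$ such that the following holds for all $n\ge1$, $a\ge0$, $d\ge1$ and $\delta\ge0$. If a depth-$d$ QAC circuit with $a$ ancillae synthesizes the $n$-qubit pure state $\varphi$ with fidelity $1-\delta$, then for every $\varepsilon\ge 10\,\delta^{1/4}+C\,d/n$, with $D=\deg_\varepsilon(\varphi)$, $$(n+a)^{1-3^{-d}/2}\ \ge\ \frac{c\,D}{\log^k(D+2)},\qquad\text{i.e. } (n+a)^{1-3^{-d}/2}=\tilde\Omega\big(\deg_\varepsilon(\varphi)\big).$$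 (2) There are absolute constants $c>0$ and $k\in\mathbb N$ such that, for all $n\ge1$, $m,a,d\ge0$ and $0\le\delta<1/10240000$: if a depth-$d$ QAC circuit with $a$ ancillae synthesizes an $n$-nekomata on $n+m$ qubits with fidelity $1-\delta$, then $$(n+m+a)^{1-3^{-d}/2}\ \ge\ \frac{c\,n}{\log^k(n+2)};$$ in particular, if it synthesizes the $n$-qubit cat state with fidelity $1-\delta$, then $(n+a)^{1-3^{-d}/2}\ge c\,n/\log^k(n+2)$. (3) Consequently, for every $0\le\delta<1/10240000$, no family $(\nu_n)_n$ with $\nu_n$ an $n$-nekomata for each $n\ge1$, on $n+m(n)$ qubits with $m(n)\ge 0$ arbitrary, is in $\mathrm{stateQLC}^0[\delta]$; in particular the family of cat states is not in $\mathrm{stateQLC}^0[\delta]$. -/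

import Mathlib

open scoped Matrix.Norms.L2Operator

noncomputable section

/-- Labels of the computational basis of `n` qubits: bit strings of length `n`. -/
abbrev Bits (n : ℕ) : Type := Fin n → Fin 2

/-- Vectors of the `2 ^ n`-dimensional Hilbert space of `n` qubits. -/
abbrev Ket (n : ℕ) : Type := Bits n → ℂ

/-- Operators on `n` qubits. With the scoped instances opened above, `‖A‖` is the spectral norm
(the operator norm for the Euclidean norm on vectors). -/
abbrev Op (n : ℕ) : Type := Matrix (Bits n) (Bits n) ℂ

/-! ### States -/

/-- `ψ` is a unit vector, i.e. a pure state. -/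
def IsPure {n : ℕ} (ψ : Ket n) : Prop := dotProduct (star ψ) ψ = 1

/-- The rank-one operator `|ψ⟩⟨ψ|`. -/
def ketbra {n : ℕ} (ψ : Ket n) : Op n := Matrix.vecMulVec ψ (star ψ)

/-- The computational basis vector `|x⟩`. -/
def basisKet {n : ℕ} (x : Bits n) : Ket n := fun y => if y = x then 1 else 0

/-- The product vector `|u⟩ ⊗ |v⟩`, with the qubits of `u` first. -/
def tensorKet {n m : ℕ} (u : Ket n) (v : Ket m) : Ket (n + m) :=
  fun x => u (fun i => x (Fin.castAdd m i)) * v (fun j => x (Fin.natAdd n j))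

/-- The cat state `(|0^n⟩ + |1^n⟩) / √2`. -/
def catKet (n : ℕ) : Ket n :=
  ((Real.sqrt 2 : ℂ)⁻¹) • (basisKet (fun _ => 0) + basisKet (fun _ => 1))

/-- `ν`, a vector on `n + m` qubits, is an `n`-nekomata: `ν = (|0^n, ψ₀⟩ + |1^n, ψ₁⟩) / √2` for
some pure states `ψ₀`, `ψ₁` on `m` qubits. -/
def IsNekomata (n m : ℕ) (ν : Ket (n + m)) : Prop :=
  ∃ ψ₀ ψ₁ : Ket m, IsPure ψ₀ ∧ IsPure ψ₁ ∧
    ν = ((Real.sqrt 2 : ℂ)⁻¹) •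
      (tensorKet (basisKet (fun _ : Fin n => 0)) ψ₀ + tensorKet (basisKet (fun _ : Fin n => 1)) ψ₁)

/-- The partial trace over the last `a` of `n + a` qubits. -/
def partialTrace {n a : ℕ} (ρ : Op (n + a)) : Op n :=
  Matrix.of fun x y => ∑ z : Bits a, ρ (Fin.append x z) (Fin.append y z)

/-- The fidelity `√⟨φ|ρ|φ⟩` between a pure state `φ` and a density operator `ρ`. -/
def pureFidelity {n : ℕ} (φ : Ket n) (ρ : Op n) : ℝ :=
  Real.sqrt (dotProduct (star φ) (ρ.mulVec φ)).re

/-! ### Pauli degree and approximate degree -/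

/-- The Pauli matrices `I, X, Y, Z`. -/
def pauli : Fin 4 → Matrix (Fin 2) (Fin 2) ℂ :=
  ![!![1, 0; 0, 1], !![0, 1; 1, 0], !![0, -Complex.I; Complex.I, 0], !![1, 0; 0, -1]]

/-- The tensor product `A₁ ⊗ ⋯ ⊗ Aₙ` of single-qubit operators. -/
def tensorOp {n : ℕ} (A : Fin n → Matrix (Fin 2) (Fin 2) ℂ) : Op n :=
  Matrix.of fun x y => ∏ i, A i (x i) (y i)

/-- The Pauli string `P_σ = P_{σ₁} ⊗ ⋯ ⊗ P_{σₙ}`. -/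
def pauliString {n : ℕ} (σ : Fin n → Fin 4) : Op n := tensorOp fun i => pauli (σ i)

/-- The coefficient of `P_σ` in the Pauli expansion of `A`: the normalized inner product
`2⁻ⁿ Tr(P_σ† A)` with an element of the orthonormal basis of Pauli strings. -/
def pauliCoeff {n : ℕ} (A : Op n) (σ : Fin n → Fin 4) : ℂ :=
  ((pauliString σ).conjTranspose * A).trace / 2 ^ n

/-- The number of non-identity factors of a Pauli string. -/
def pauliWeight {n : ℕ} (σ : Fin n → Fin 4) : ℕ := (Finset.univ.filter fun i => σ i ≠ 0).card

open Classical in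
/-- The degree of `A`: the largest weight in its Pauli expansion (`0` for `A = 0`). -/
def pauliDegree {n : ℕ} (A : Op n) : ℕ :=
  (Finset.univ.filter fun σ : Fin n → Fin 4 => pauliCoeff A σ ≠ 0).sup pauliWeight

/-- The approximate degree: the least degree of an operator within spectral distance `ε` of `A`. -/
def approxDegree {n : ℕ} (ε : ℝ) (A : Op n) : ℕ :=
  sInf {k | ∃ B : Op n, ‖A - B‖ ≤ ε ∧ pauliDegree B = k}

/-! ### Circuits -/

/-- The projector onto the span of the basis vectors all of whose bits in `S` are `1`, that is,
`|1⟩⟨1|` on every qubit of `S` and the identity on the other qubits. -/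
def onesProj {N : ℕ} (S : Finset (Fin N)) : Op N :=
  Matrix.diagonal fun x => if ∀ i ∈ S, x i = 1 then 1 else 0

/-- The multi-qubit CZ gate `I - 2 |1^S⟩⟨1^S|` on the qubits of `S`, the identity elsewhere. -/
def czGate {N : ℕ} (S : Finset (Fin N)) : Op N := 1 - (2 : ℂ) • onesProj S

/-- A layer of CZ gates of arbitrary arity on pairwise disjoint sets of qubits. -/
structure CZLayer (N : ℕ) where
  gates : List (Finset (Fin N))
  nonempty : ∀ S ∈ gates, S.Nonempty
  disjoint : gates.Pairwise Disjoint

/-- The unitary of a layer of CZ gates. -/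
def CZLayer.toOp {N : ℕ} (M : CZLayer N) : Op N := (M.gates.map czGate).prod

/-- A layer of single-qubit unitaries, one for each qubit. -/
abbrev LocalLayer (N : ℕ) : Type := Fin N → Matrix.unitaryGroup (Fin 2) ℂ

/-- The unitary of a layer of single-qubit unitaries. -/
def LocalLayer.toOp {N : ℕ} (L : LocalLayer N) : Op N :=
  tensorOp fun i => (L i : Matrix (Fin 2) (Fin 2) ℂ)

/-- QAC circuits of depth `d` on `N` qubits: `L_d M_d ⋯ L_1 M_1 L_0` with layers `L_i` of
single-qubit unitaries and layers `M_i` of CZ gates. -/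
inductive QACCircuit (N : ℕ) : ℕ → Type
  | base (L : LocalLayer N) : QACCircuit N 0
  | step {d : ℕ} (C : QACCircuit N d) (M : CZLayer N) (L : LocalLayer N) : QACCircuit N (d + 1)

/-- The unitary implemented by a circuit. -/
def QACCircuit.toOp {N : ℕ} : {d : ℕ} → QACCircuit N d → Op N
  | _, .base L => LocalLayer.toOp L
  | _, .step C M L => LocalLayer.toOp L * M.toOp * C.toOp

/-- The circuit `U` on `n + a` qubits synthesizes the `n`-qubit pure state `φ` with `a` ancillae and
fidelity `1 - δ`: the first `n` qubits of `U|0^{n+a}⟩` have fidelity at least `1 - δ` with `φ`. -/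
def Synthesizes {n a d : ℕ} (U : QACCircuit (n + a) d) (φ : Ket n) (δ : ℝ) : Prop :=
  1 - δ ≤ pureFidelity φ
    (partialTrace (U.toOp * ketbra (basisKet fun _ => 0) * U.toOp.conjTranspose))

/-- The class `stateQLC⁰[δ]`, for families whose `n`-th member is a state on `q n` qubits: circuits
of constant depth, acting on `O(n)` qubits in total (so, for `q n = n`, with `O(n)` ancillae), one
for each `n ≥ 1`, that synthesize the `n`-th member with fidelity `1 - δ`. -/
def stateQLC0 (q : ℕ → ℕ) (δ : ℝ) : Set ((n : ℕ) → Ket (q n)) :=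
  {ψ | ∃ D A : ℕ, ∀ n : ℕ, 1 ≤ n → ∃ d a : ℕ, d ≤ D ∧ q n + a ≤ A * n ∧
    ∃ U : QACCircuit (q n + a) d, Synthesizes U (ψ n) δ}

end

/-! The projector onto the output of a shallow circuit on `N` qubits is close in spectral norm to an
operator of degree about `N ^ (1 - 3⁻ᵈ / 2)`, whereas a nekomata projector is far from every
operator of degree less than `n`.

Upper bound. The projector onto `|0^N⟩` is a conjunction, so a Chebyshev polynomial in the number of
matching bits gives an approximant of degree `O(s √N)` with error `4⁻ˢ` (`exists_and_polynomial`).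
For a layer of CZ gates, fix a threshold `b`. Conjugation by the gates on at most `b` qubits
enlarges supports by a factor at most `b` (`small_conj_mem_lowDegree`). Each larger gate is itself a
conjunction, and replacing all of them by polynomials adds degree only `O(s N / √b)`, since the
gates are disjoint (`exists_approx_big_gates`). If the degree before the layer is of order `N ^ (1 -
3θ/2)`, then `b ≈ N ^ θ` balances both costs at `N ^ (1 - θ/2)`; thus each layer divides the saving
in the exponent by three (`exists_approx_circuit`). All approximants have norm at most 1, so errors
add up and are not amplified.

To discard the ancillae, choose an ancilla state `η` for which `φ ⊗ η` overlaps the output exactly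
as much as the fidelity says (`exists_ancilla_overlap`). Compression along `η` is a contraction that
does not raise degree, so `ketbra φ` inherits the approximation (`exists_approx_of_synthesizes`).

Lower bound. An operator of degree below `n` has zero matrix element between the two branches of a
nekomata, while the projector has `1/2` there (`half_le_norm_nekomata_sub`). With `s` of order `log
N` the error is at most `(4d + 1) / N` plus the fidelity loss, which yields the size bounds. For
constant depth and linear size these bounds contradict `log n = n ^ o(1)`. -/

/-! ### Locality of operators -/

/-- The span of the product operators that act as the identity outside some set of `k` qubits. -/
def lowDegree (n k : ℕ) : Submodule ℂ (Op n) :=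
  Submodule.span ℂ {X | ∃ (T : Finset (Fin n)) (A : Fin n → Matrix (Fin 2) (Fin 2) ℂ),
    T.card ≤ k ∧ (∀ i ∉ T, A i = 1) ∧ tensorOp A = X}

/-- The span of the product operators that act as the identity outside `T`. -/
def supportedOn {n : ℕ} (T : Finset (Fin n)) : Submodule ℂ (Op n) :=
  Submodule.span ℂ {X | ∃ A : Fin n → Matrix (Fin 2) (Fin 2) ℂ, (∀ i ∉ T, A i = 1) ∧ tensorOp A = X}

lemma tensorOp_mul {n : ℕ} (A B : Fin n → Matrix (Fin 2) (Fin 2) ℂ) :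
    tensorOp A * tensorOp B = tensorOp fun i => A i * B i := by
  ext x y
  simp only [tensorOp, Matrix.mul_apply, Matrix.of_apply, Finset.prod_univ_sum,
    Fintype.piFinset_univ, Finset.prod_mul_distrib]

lemma tensorOp_one {n : ℕ} : tensorOp (fun _ : Fin n => 1) = 1 := by
  ext x y
  simp only [tensorOp, Matrix.of_apply, Matrix.one_apply, Finset.prod_ite_zero, Finset.prod_const_one,
    Finset.mem_univ, true_imp_iff, funext_iff]

lemma conjTranspose_tensorOp {n : ℕ} (A : Fin n → Matrix (Fin 2) (Fin 2) ℂ) :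
    (tensorOp A).conjTranspose = tensorOp fun i => (A i).conjTranspose := by
  ext x y
  simp [tensorOp, Matrix.conjTranspose_apply]

lemma trace_tensorOp {n : ℕ} (A : Fin n → Matrix (Fin 2) (Fin 2) ℂ) :
    (tensorOp A).trace = ∏ i, (A i).trace := by
  simp only [tensorOp, Matrix.trace, Matrix.diag, Matrix.of_apply, Finset.prod_univ_sum,
    Fintype.piFinset_univ]

lemma tensorOp_mem_lowDegree {n k : ℕ} {A : Fin n → Matrix (Fin 2) (Fin 2) ℂ} (T : Finset (Fin n))
    (hT : T.card ≤ k) (hA : ∀ i ∉ T, A i = 1) : tensorOp A ∈ lowDegree n k :=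
  Submodule.subset_span ⟨T, A, hT, hA, rfl⟩

lemma lowDegree_mono {n k l : ℕ} (h : k ≤ l) : lowDegree n k ≤ lowDegree n l :=
  Submodule.span_mono fun _ ⟨T, A, hT, hA⟩ => ⟨T, A, hT.trans h, hA⟩

/-- Every matrix unit is a product of single-qubit matrix units. This is the fallback when no useful
degree bound is available. -/
lemma lowDegree_self {n : ℕ} (X : Op n) : X ∈ lowDegree n n := by
  rw [Matrix.matrix_eq_sum_single X]
  refine Submodule.sum_mem _ fun x _ => Submodule.sum_mem _ fun y _ => ?_
  have h : Matrix.single x y (X x y) =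
      X x y • tensorOp fun i => Matrix.single (x i) (y i) (1 : ℂ) := by
    ext u v
    simp only [tensorOp, Matrix.single_apply, Matrix.smul_apply, Matrix.of_apply, smul_eq_mul,
      Finset.prod_ite_zero, Finset.prod_const_one, Finset.mem_univ, true_imp_iff, funext_iff,
      forall_and, mul_ite, mul_one, mul_zero]
  rw [h]
  exact Submodule.smul_mem _ _ (tensorOp_mem_lowDegree Finset.univ (by simp) (by simp))

lemma one_mem_lowDegree {n k : ℕ} : (1 : Op n) ∈ lowDegree n k := by
  rw [← tensorOp_one]
  exact tensorOp_mem_lowDegree ∅ (by simp) (by simp)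

lemma mul_mem_lowDegree {n k l : ℕ} {X Y : Op n} (hX : X ∈ lowDegree n k)
    (hY : Y ∈ lowDegree n l) : X * Y ∈ lowDegree n (k + l) := by
  classical
  have h := Submodule.mul_mem_mul hX hY
  rw [lowDegree, lowDegree, Submodule.span_mul_span] at h
  refine Submodule.span_mono ?_ h
  rintro _ ⟨_, ⟨S, A, hS, hA, rfl⟩, _, ⟨T, B, hT, hB, rfl⟩, rfl⟩
  refine ⟨S ∪ T, _, (Finset.card_union_le _ _).trans (add_le_add hS hT), fun i hi => ?_,
    (tensorOp_mul A B).symm⟩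
  simp only [Finset.mem_union, not_or] at hi
  simp [hA i hi.1, hB i hi.2]

lemma pow_mem_lowDegree {n k : ℕ} {X : Op n} (hX : X ∈ lowDegree n k) (r : ℕ) :
    X ^ r ∈ lowDegree n (r * k) := by
  induction r with
  | zero => simpa using one_mem_lowDegree
  | succ r ih => rw [pow_succ, Nat.succ_mul]; exact mul_mem_lowDegree ih hX

lemma aeval_mem_lowDegree {n k : ℕ} {X : Op n} (hX : X ∈ lowDegree n k) (p : Polynomial ℂ) :
    Polynomial.aeval X p ∈ lowDegree n (p.natDegree * k) := by
  rw [Polynomial.aeval_eq_sum_range]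
  refine Submodule.sum_mem _ fun r hr => Submodule.smul_mem _ _ ?_
  refine lowDegree_mono ?_ (pow_mem_lowDegree hX r)
  exact Nat.mul_le_mul_right _ (Nat.lt_succ_iff.mp (Finset.mem_range.mp hr))

lemma supportedOn_le_lowDegree {n k : ℕ} {T : Finset (Fin n)} (hT : T.card ≤ k) :
    supportedOn T ≤ lowDegree n k :=
  Submodule.span_mono fun _ ⟨A, hA⟩ => ⟨T, A, hT, hA⟩

lemma tensorOp_mem_supportedOn {n : ℕ} {T : Finset (Fin n)} {A : Fin n → Matrix (Fin 2) (Fin 2) ℂ}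
    (hA : ∀ i ∉ T, A i = 1) : tensorOp A ∈ supportedOn T :=
  Submodule.subset_span ⟨A, hA, rfl⟩

lemma one_mem_supportedOn {n : ℕ} {T : Finset (Fin n)} : (1 : Op n) ∈ supportedOn T := by
  rw [← tensorOp_one]
  exact tensorOp_mem_supportedOn (by simp)

lemma mul_mem_supportedOn {n : ℕ} {T : Finset (Fin n)} {X Y : Op n} (hX : X ∈ supportedOn T)
    (hY : Y ∈ supportedOn T) : X * Y ∈ supportedOn T := by
  have h := Submodule.mul_mem_mul hX hY
  rw [supportedOn, Submodule.span_mul_span] at h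
  refine Submodule.span_mono ?_ h
  rintro _ ⟨_, ⟨A, hA, rfl⟩, _, ⟨B, hB, rfl⟩, rfl⟩
  exact ⟨_, fun i hi => by simp [hA i hi, hB i hi], (tensorOp_mul A B).symm⟩

lemma local_conj_mem_lowDegree {n k : ℕ} (L : LocalLayer n) {X : Op n} (hX : X ∈ lowDegree n k) :
    L.toOp * X * L.toOp.conjTranspose ∈ lowDegree n k := by
  induction hX using Submodule.span_induction with
  | mem X h =>
    obtain ⟨T, A, hT, hA, rfl⟩ := h
    rw [LocalLayer.toOp, conjTranspose_tensorOp, tensorOp_mul, tensorOp_mul]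
    refine tensorOp_mem_lowDegree T hT fun i hi => ?_
    rw [hA i hi, mul_one]
    exact Matrix.mem_unitaryGroup_iff.mp (L i).2
  | zero => simp
  | add X Y _ _ hX hY => rw [mul_add, add_mul]; exact add_mem hX hY
  | smul c X _ hX => rw [mul_smul_comm, smul_mul_assoc]; exact Submodule.smul_mem _ _ hX

lemma LocalLayer.toOp_mem_unitary {n : ℕ} (L : LocalLayer n) : L.toOp ∈ unitary (Op n) := by
  have h (A : Fin n → Matrix (Fin 2) (Fin 2) ℂ) (hA : ∀ i, A i = 1) : tensorOp A = 1 := by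
    rw [← tensorOp_one]; congr; ext1 i; exact hA i
  rw [Unitary.mem_iff, Matrix.star_eq_conjTranspose, LocalLayer.toOp, conjTranspose_tensorOp,
    tensorOp_mul, tensorOp_mul]
  exact ⟨h _ fun i => Matrix.mem_unitaryGroup_iff'.mp (L i).2,
    h _ fun i => Matrix.mem_unitaryGroup_iff.mp (L i).2⟩

lemma trace_pauli {s : Fin 4} (hs : s ≠ 0) : (pauli s).conjTranspose.trace = 0 := by
  rw [Matrix.trace_conjTranspose]
  fin_cases s <;> simp [pauli, Matrix.trace_fin_two] at hs ⊢

/-- A Pauli string of weight above `k` has a non-identity factor outside any set of `k` qubits; that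
factor is traceless, which kills the coefficient. Only this direction is needed to pass from spans
of local operators to Pauli degree. -/
lemma pauliDegree_le_of_mem_lowDegree {n k : ℕ} {X : Op n} (hX : X ∈ lowDegree n k) :
    pauliDegree X ≤ k := by
  classical
  refine Finset.sup_le fun σ hσ => ?_
  by_contra! hk
  refine (Finset.mem_filter.mp hσ).2 ?_
  suffices h : ((pauliString σ).conjTranspose * X).trace = 0 by rw [pauliCoeff, h, zero_div]
  clear hσ
  induction hX using Submodule.span_induction with
  | mem X h =>
    obtain ⟨T, A, hT, hA, rfl⟩ := h
    obtain ⟨i, hi, hiT⟩ := Finset.exists_mem_notMem_of_card_lt_card (hT.trans_lt hk)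
    rw [pauliString, conjTranspose_tensorOp, tensorOp_mul, trace_tensorOp]
    refine Finset.prod_eq_zero (Finset.mem_univ i) ?_
    rw [hA i hiT, mul_one, trace_pauli (Finset.mem_filter.mp hi).2]
  | zero => simp
  | add X Y _ _ hX hY => rw [mul_add, Matrix.trace_add, hX, hY, add_zero]
  | smul c X _ hX => rw [mul_smul_comm, Matrix.trace_smul, hX, smul_zero]

lemma approxDegree_le_of_mem_lowDegree {n k : ℕ} {ε : ℝ} {X B : Op n} (h : ‖X - B‖ ≤ ε)
    (hB : B ∈ lowDegree n k) : approxDegree ε X ≤ k :=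
  have h' : approxDegree ε X ≤ pauliDegree B := Nat.sInf_le ⟨B, h, rfl⟩
  h'.trans (pauliDegree_le_of_mem_lowDegree hB)

/-! ### Polynomial approximation of the conjunction -/

-- The recurrence gives `T_{r+2} - T_{r+1} = (T_{r+1} - T_r) + 2y T_{r+1}` at `1 + y`, so increments
-- grow by at least `2y`. The induction therefore carries a bound on the increment too.
open Polynomial in
lemma one_add_sq_mul_le_eval_chebyshev (r : ℕ) {y : ℝ} (hy : 0 ≤ y) :
    1 + (r : ℝ) ^ 2 * y ≤ (Chebyshev.T ℝ r).eval (1 + y) := by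
  suffices h : 1 + (r : ℝ) ^ 2 * y ≤ (Chebyshev.T ℝ r).eval (1 + y) ∧
      (2 * r + 1) * y ≤ (Chebyshev.T ℝ ((r : ℤ) + 1)).eval (1 + y) -
        (Chebyshev.T ℝ r).eval (1 + y) from h.1
  induction r with
  | zero => simp
  | succ r ih =>
    obtain ⟨h1, h2⟩ := ih
    have h3 := congrArg (Polynomial.eval (1 + y)) (Chebyshev.T_add_two ℝ (r : ℤ))
    simp only [eval_sub, eval_mul, eval_X, eval_ofNat] at h3
    push_cast
    rw [show (r : ℤ) + 1 + 1 = r + 2 by ring, h3]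
    have h4 : 0 ≤ (r : ℝ) ^ 2 * y := by positivity
    have h5 : 0 ≤ ((r : ℝ) + 1) ^ 2 * y := by positivity
    have h6 : 1 + ((r : ℝ) + 1) ^ 2 * y ≤ (Chebyshev.T ℝ ((r : ℤ) + 1)).eval (1 + y) := by
      linarith
    exact ⟨h6, by nlinarith⟩

-- Rescaling by `(k + 1) / m` puts `k < m` into `[0, 1]`, where `T_r` is bounded by 1, and puts `k =
-- m` at `1 + 1/m`, where `r² ≥ m` forces `T_r ≥ 2`. Normalizing and raising to the power `2s` gives
-- the decay; the even exponent also gives nonnegativity, which later keeps the approximate gates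
-- contractive.
open Polynomial in
lemma exists_and_polynomial {m : ℕ} (hm : 0 < m) (s : ℕ) :
    ∃ p : ℝ[X], p.natDegree ≤ 2 * s * (m.sqrt + 1) ∧ p.eval (m : ℝ) = 1 ∧
      ∀ k : ℕ, k < m → 0 ≤ p.eval (k : ℝ) ∧ p.eval (k : ℝ) ≤ ((4 : ℝ) ^ s)⁻¹ := by
  set r : ℕ := m.sqrt + 1
  have hm' : (0 : ℝ) < m := by exact_mod_cast hm
  set t : ℝ := (Chebyshev.T ℝ r).eval (1 + (m : ℝ)⁻¹)
  have ht : 2 ≤ t := by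
    refine le_trans ?_ (one_add_sq_mul_le_eval_chebyshev r (by positivity))
    have h : (m : ℝ) ≤ (r : ℝ) ^ 2 := by
      have := (Nat.lt_succ_sqrt m).le
      rw [← pow_two] at this
      exact_mod_cast this
    have : 1 ≤ (r : ℝ) ^ 2 * (m : ℝ)⁻¹ := by
      rw [← div_eq_mul_inv, le_div_iff₀ hm']; linarith
    linarith
  have heval (x : ℝ) : ((C t⁻¹ * (Chebyshev.T ℝ r).comp (C (m : ℝ)⁻¹ * (X + 1))) ^ (2 * s)).eval x
      = (t⁻¹ * (Chebyshev.T ℝ r).eval ((m : ℝ)⁻¹ * (x + 1))) ^ (2 * s) := by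
    simp [eval_comp]
  refine ⟨(C t⁻¹ * (Chebyshev.T ℝ r).comp (C (m : ℝ)⁻¹ * (X + 1))) ^ (2 * s), ?_, ?_, ?_⟩
  · refine natDegree_pow_le.trans (Nat.mul_le_mul_left _ ?_)
    refine (natDegree_C_mul_le _ _).trans (natDegree_comp_le.trans ?_)
    have h1 : (C (m : ℝ)⁻¹ * (X + 1)).natDegree ≤ 1 :=
      (natDegree_C_mul_le _ _).trans (natDegree_X_add_C (1 : ℝ)).le
    have h2 : (Chebyshev.T ℝ r).natDegree = r := by simp
    rw [h2]
    exact (Nat.mul_le_mul_left r h1).trans (by omega)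
  · rw [heval, show (m : ℝ)⁻¹ * (m + 1) = 1 + (m : ℝ)⁻¹ by field_simp,
      inv_mul_cancel₀ (by linarith), one_pow]
  · intro k hk
    rw [heval, pow_mul]
    refine ⟨by positivity, ?_⟩
    rw [← inv_pow]
    refine pow_le_pow_left₀ (by positivity) ?_ s
    have hk' : (k : ℝ) + 1 ≤ m := by exact_mod_cast hk
    have h1 : |(Chebyshev.T ℝ r).eval ((m : ℝ)⁻¹ * (k + 1))| ≤ 1 := by
      refine Chebyshev.abs_eval_T_real_le_one r ?_
      rw [abs_of_nonneg (by positivity), inv_mul_le_iff₀ hm']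
      linarith
    have h2 : t⁻¹ ≤ 2⁻¹ := inv_anti₀ (by norm_num) ht
    have h3 : 0 ≤ t⁻¹ := by positivity
    rw [mul_pow]
    calc t⁻¹ ^ 2 * _ ≤ 2⁻¹ ^ 2 * 1 := by
          refine mul_le_mul (pow_le_pow_left₀ h3 h2 2) ?_ (sq_nonneg _) (by norm_num)
          rw [← sq_abs]; exact pow_le_one₀ (abs_nonneg _) h1
      _ = 4⁻¹ := by norm_num

/-! ### Approximation of gates -/

/-- The projector onto the value `b` of the qubit `i`. -/
def bitProj {N : ℕ} (b : Fin 2) (i : Fin N) : Op N :=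
  Matrix.diagonal fun x => if x i = b then 1 else 0

/-- The projector onto the value `b` of all the qubits in `S` is a product operator. -/
lemma diagonal_eq_tensorOp {N : ℕ} (b : Fin 2) (S : Finset (Fin N)) :
    (Matrix.diagonal fun x : Bits N => if ∀ i ∈ S, x i = b then (1 : ℂ) else 0) =
      tensorOp fun i => if i ∈ S then Matrix.diagonal fun y => if y = b then 1 else 0 else 1 := by
  ext x y
  simp only [tensorOp, Matrix.of_apply, Matrix.diagonal_apply]
  by_cases hxy : x = y
  · subst hxy
    rw [if_pos rfl]
    split_ifs with h
    · refine (Finset.prod_eq_one fun i _ => ?_).symm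
      split_ifs with hi <;> simp [h, hi]
    · push Not at h
      obtain ⟨i, hi, hb⟩ := h
      exact (Finset.prod_eq_zero (Finset.mem_univ i) (by simp [hi, hb])).symm
  · rw [if_neg hxy]
    obtain ⟨i, hi⟩ := Function.ne_iff.mp hxy
    refine (Finset.prod_eq_zero (Finset.mem_univ i) ?_).symm
    split_ifs <;> simp [hi]

lemma bitProj_mem_lowDegree {N : ℕ} (b : Fin 2) (i : Fin N) : bitProj b i ∈ lowDegree N 1 := by
  have h := diagonal_eq_tensorOp b {i}
  simp only [Finset.mem_singleton, forall_eq] at h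
  rw [bitProj, h]
  exact tensorOp_mem_lowDegree {i} (by simp) fun j hj => by simp_all

/-- The sum of the `bitProj b i` over `S` is diagonal, counts the matching bits and has degree 1;
the conjunction polynomial is evaluated at it. -/
lemma exists_diagonal_and {N : ℕ} (b : Fin 2) {S : Finset (Fin N)} (hS : S.Nonempty) (s : ℕ) :
    ∃ q : Bits N → ℝ, Matrix.diagonal (fun x => (q x : ℂ)) ∈
        lowDegree N (2 * s * (S.card.sqrt + 1)) ∧
      (∀ x, (∀ i ∈ S, x i = b) → q x = 1) ∧
      ∀ x, (¬ ∀ i ∈ S, x i = b) → 0 ≤ q x ∧ q x ≤ ((4 : ℝ) ^ s)⁻¹ := by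
  classical
  obtain ⟨p, hdeg, h1, h2⟩ := exists_and_polynomial hS.card_pos s
  refine ⟨fun x => p.eval (((S.filter fun i => x i = b).card : ℕ) : ℝ), ?_, ?_, ?_⟩
  · have hsum : ∑ i ∈ S, bitProj b i ∈ lowDegree N 1 :=
      Submodule.sum_mem _ fun i _ => bitProj_mem_lowDegree b i
    have h := aeval_mem_lowDegree hsum (p.map (algebraMap ℝ ℂ))
    have hd : ∑ i ∈ S, bitProj b i = Matrix.diagonalAlgHom ℂ
        (fun x : Bits N => (((S.filter fun i => x i = b).card : ℝ) : ℂ)) := by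
      ext x y
      simp only [bitProj, Matrix.sum_apply, Matrix.diagonalAlgHom_apply, Matrix.diagonal_apply]
      split_ifs <;> simp
    rw [hd, Polynomial.aeval_algHom_apply] at h
    have hk : (p.map (algebraMap ℝ ℂ)).natDegree * 1 ≤ 2 * s * (S.card.sqrt + 1) := by
      rw [mul_one]; exact Polynomial.natDegree_map_le.trans hdeg
    convert! lowDegree_mono hk h using 1
    rw [Matrix.diagonalAlgHom_apply]
    congr 1
    ext x
    rw [Polynomial.aeval_fn_apply, Polynomial.aeval_map_algebraMap]
    exact (Polynomial.aeval_algebraMap_apply_eq_algebraMap_eval (A := ℂ) (_ : ℝ) p).symm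
  · intro x hx
    simp only [Finset.filter_true_of_mem hx, h1]
  · intro x hx
    exact h2 _ (Finset.card_lt_card (Finset.filter_ssubset.mpr (by push Not at hx; exact hx)))

lemma norm_diagonal_le {N : ℕ} {f : Bits N → ℂ} {c : ℝ} (hc : 0 ≤ c) (h : ∀ x, ‖f x‖ ≤ c) :
    ‖(Matrix.diagonal f : Op N)‖ ≤ c := by
  rw [Matrix.l2_opNorm_diagonal]
  exact (pi_norm_le_iff_of_nonneg hc).mpr h

lemma czGate_eq_diagonal {N : ℕ} (S : Finset (Fin N)) :
    czGate S = Matrix.diagonal fun x => if ∀ i ∈ S, x i = 1 then -1 else 1 := by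
  ext x y
  simp only [czGate, onesProj, Matrix.sub_apply, Matrix.one_apply, Matrix.smul_apply,
    Matrix.diagonal_apply]
  split_ifs <;> norm_num

lemma exists_approx_czGate {N : ℕ} {S : Finset (Fin N)} (hS : S.Nonempty) (s : ℕ) :
    ∃ G ∈ lowDegree N (2 * s * (S.card.sqrt + 1)), ‖G‖ ≤ 1 ∧
      ‖czGate S - G‖ ≤ 2 * ((4 : ℝ) ^ s)⁻¹ := by
  obtain ⟨q, hq, h1, h2⟩ := exists_diagonal_and (1 : Fin 2) hS s
  have hs : ((4 : ℝ) ^ s)⁻¹ ≤ 1 := inv_le_one_of_one_le₀ (one_le_pow₀ (by norm_num))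
  have hG : (1 : Op N) - (2 : ℂ) • Matrix.diagonal (fun x => (q x : ℂ)) =
      Matrix.diagonal fun x => ((1 - 2 * q x : ℝ) : ℂ) := by
    ext x y
    simp only [Matrix.sub_apply, Matrix.one_apply, Matrix.smul_apply, Matrix.diagonal_apply]
    split_ifs <;> simp
  refine ⟨1 - (2 : ℂ) • Matrix.diagonal fun x => (q x : ℂ),
    sub_mem one_mem_lowDegree (Submodule.smul_mem _ _ hq), ?_, ?_⟩
  -- Since `q` takes values in `[0, 1]`, the entries `1 - 2q` stay in `[-1, 1]`.
  · rw [hG]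
    refine norm_diagonal_le zero_le_one fun x => ?_
    rw [Complex.norm_real, Real.norm_eq_abs, abs_le]
    by_cases h : ∀ i ∈ S, x i = 1
    · rw [h1 x h]; norm_num
    · obtain ⟨h3, h4⟩ := h2 x h
      constructor <;> linarith
  · rw [hG, czGate_eq_diagonal, Matrix.diagonal_sub]
    refine norm_diagonal_le (by positivity) fun x => ?_
    split_ifs with h
    · rw [h1 x h]; norm_num
    · obtain ⟨h3, h4⟩ := h2 x h
      rw [← Complex.ofReal_one, ← Complex.ofReal_sub, Complex.norm_real, Real.norm_eq_abs,
        sub_sub_cancel, abs_of_nonneg (by linarith)]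
      linarith

lemma exists_approx_ketbra_zero {N : ℕ} (hN : 0 < N) (s : ℕ) :
    ∃ B ∈ lowDegree N (2 * s * (N.sqrt + 1)), ‖B‖ ≤ 1 ∧
      ‖ketbra (basisKet fun _ => 0) - B‖ ≤ ((4 : ℝ) ^ s)⁻¹ := by
  have : Nonempty (Fin N) := ⟨⟨0, hN⟩⟩
  obtain ⟨q, hq, h1, h2⟩ := exists_diagonal_and (0 : Fin 2) (Finset.univ_nonempty (α := Fin N)) s
  rw [Finset.card_univ, Fintype.card_fin] at hq
  have hs : ((4 : ℝ) ^ s)⁻¹ ≤ 1 := inv_le_one_of_one_le₀ (one_le_pow₀ (by norm_num))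
  have hk : ketbra (basisKet fun _ : Fin N => 0) =
      Matrix.diagonal fun x => if ∀ i ∈ Finset.univ, x i = 0 then (1 : ℂ) else 0 := by
    ext x y
    simp only [ketbra, Matrix.vecMulVec_apply, basisKet, Pi.star_apply, Matrix.diagonal_apply,
      Finset.mem_univ, true_imp_iff, funext_iff]
    by_cases hx : ∀ i, x i = 0 <;> by_cases hy : ∀ i, y i = 0 <;> simp [hx, hy]
    push Not at hy
    simpa [eq_comm] using hy
  refine ⟨_, hq, ?_, ?_⟩
  · refine norm_diagonal_le zero_le_one fun x => ?_
    rw [Complex.norm_real, Real.norm_eq_abs, abs_le]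
    by_cases h : ∀ i ∈ Finset.univ, x i = 0
    · rw [h1 x h]; norm_num
    · obtain ⟨h3, h4⟩ := h2 x h
      constructor <;> linarith
  · rw [hk, Matrix.diagonal_sub]
    refine norm_diagonal_le (by positivity) fun x => ?_
    split_ifs with h
    · rw [h1 x h]; simp
    · obtain ⟨h3, h4⟩ := h2 x h
      rw [zero_sub, norm_neg, Complex.norm_real, Real.norm_eq_abs, abs_of_nonneg h3]
      exact h4

/-! ### Conjugation by a layer of gates -/

lemma conjTranspose_mem_lowDegree {n k : ℕ} {X : Op n} (hX : X ∈ lowDegree n k) :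
    X.conjTranspose ∈ lowDegree n k := by
  induction hX using Submodule.span_induction with
  | mem X h =>
    obtain ⟨T, A, hT, hA, rfl⟩ := h
    rw [conjTranspose_tensorOp]
    exact tensorOp_mem_lowDegree T hT fun i hi => by simp [hA i hi]
  | zero => simp
  | add X Y _ _ hX hY => rw [Matrix.conjTranspose_add]; exact add_mem hX hY
  | smul c X _ hX => rw [Matrix.conjTranspose_smul]; exact Submodule.smul_mem _ _ hX

lemma conjTranspose_mem_supportedOn {n : ℕ} {T : Finset (Fin n)} {X : Op n}
    (hX : X ∈ supportedOn T) : X.conjTranspose ∈ supportedOn T := by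
  induction hX using Submodule.span_induction with
  | mem X h =>
    obtain ⟨A, hA, rfl⟩ := h
    rw [conjTranspose_tensorOp]
    exact tensorOp_mem_supportedOn fun i hi => by simp [hA i hi]
  | zero => simp
  | add X Y _ _ hX hY => rw [Matrix.conjTranspose_add]; exact add_mem hX hY
  | smul c X _ hX => rw [Matrix.conjTranspose_smul]; exact Submodule.smul_mem _ _ hX

lemma czGate_mem_unitary {N : ℕ} (S : Finset (Fin N)) : czGate S ∈ unitary (Op N) := by
  have h1 : star (czGate S) = czGate S := by
    rw [czGate_eq_diagonal, Matrix.star_eq_conjTranspose, Matrix.diagonal_conjTranspose]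
    congr 1
    ext x
    rw [Pi.star_apply]
    split_ifs <;> simp
  have h2 : czGate S * czGate S = 1 := by
    rw [czGate_eq_diagonal, Matrix.diagonal_mul_diagonal, ← Matrix.diagonal_one]
    congr 1
    ext x
    split_ifs <;> simp
  rw [Unitary.mem_iff, h1]
  exact ⟨h2, h2⟩

lemma prod_czGate_mem_unitary {N : ℕ} (l : List (Finset (Fin N))) :
    (l.map czGate).prod ∈ unitary (Op N) := by
  refine Submonoid.list_prod_mem _ fun X hX => ?_
  obtain ⟨S, -, rfl⟩ := List.mem_map.mp hX
  exact czGate_mem_unitary S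

lemma commute_czGate {N : ℕ} (S T : Finset (Fin N)) : Commute (czGate S) (czGate T) := by
  rw [commute_iff_eq, czGate_eq_diagonal, czGate_eq_diagonal, Matrix.diagonal_mul_diagonal,
    Matrix.diagonal_mul_diagonal]
  simp_rw [mul_comm]

lemma prod_czGate_filter {N : ℕ} (p : Finset (Fin N) → Bool) (l : List (Finset (Fin N))) :
    (l.map czGate).prod =
      ((l.filter p).map czGate).prod * ((l.filter fun S => !p S).map czGate).prod := by
  induction l with
  | nil => simp
  | cons S l ih =>
    cases h : p S with
    | true => simp [h, ih, mul_assoc]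
    | false =>
      have hc : Commute (czGate S) ((l.filter p).map czGate).prod :=
        Commute.list_prod_right _ _ fun X hX => by
          obtain ⟨T, -, rfl⟩ := List.mem_map.mp hX
          exact commute_czGate S T
      simp only [h, List.map_cons, List.prod_cons, ih, Bool.false_eq_true, not_false_eq_true,
        List.filter_cons_of_neg, Bool.not_false, List.filter_cons_of_pos]
      rw [← mul_assoc, hc.eq, mul_assoc]

lemma onesProj_eq_tensorOp {N : ℕ} (S : Finset (Fin N)) :
    onesProj S = tensorOp fun i => if i ∈ S then Matrix.diagonal fun y => if y = 1 then 1 else 0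
      else 1 :=
  diagonal_eq_tensorOp 1 S

lemma czGate_mem_supportedOn {N : ℕ} {S T : Finset (Fin N)} (h : S ⊆ T) :
    czGate S ∈ supportedOn T := by
  refine sub_mem one_mem_supportedOn (Submodule.smul_mem _ _ ?_)
  rw [onesProj_eq_tensorOp]
  exact tensorOp_mem_supportedOn fun i hi => if_neg fun hS => hi (h hS)

lemma commute_czGate_tensorOp {N : ℕ} {S T : Finset (Fin N)} (h : Disjoint S T)
    {A : Fin N → Matrix (Fin 2) (Fin 2) ℂ} (hA : ∀ i ∉ T, A i = 1) :
    Commute (czGate S) (tensorOp A) := by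
  refine (Commute.one_left _).sub_left (Commute.smul_left ?_ _)
  rw [commute_iff_eq, onesProj_eq_tensorOp, tensorOp_mul, tensorOp_mul]
  congr 1
  ext1 i
  by_cases hi : i ∈ S
  · rw [hA i (Finset.disjoint_left.mp h hi), one_mul, mul_one]
  · rw [if_neg hi, one_mul, mul_one]

lemma norm_le_one_of_mem_unitary {N : ℕ} {U : Op N} (hU : U ∈ unitary (Op N)) : ‖U‖ ≤ 1 :=
  (CStarRing.norm_of_mem_unitary hU).le

/-- Light-cone argument: gates that miss the support `T` of a product operator cancel against their
adjoints, and the remaining ones enlarge each qubit of `T` to at most one gate. -/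
lemma small_conj_mem_lowDegree {N b k : ℕ} (hb : 1 ≤ b) {l : List (Finset (Fin N))}
    (hl : l.Pairwise Disjoint) (hcard : ∀ S ∈ l, S.card ≤ b) {X : Op N} (hX : X ∈ lowDegree N k) :
    (l.map czGate).prod * X * (l.map czGate).prod.conjTranspose ∈ lowDegree N (k * b) := by
  classical
  induction hX using Submodule.span_induction with
  | mem X h =>
    obtain ⟨T, A, hT, hA, rfl⟩ := h
    -- The light cone of `i`: by disjointness it is the single gate through `i`, or `{i}` if there
    -- is none.
    let g : Fin N → Finset (Fin N) := fun i => {j | j = i ∨ ∃ S ∈ l, i ∈ S ∧ j ∈ S}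
    have hg (i : Fin N) : (g i).card ≤ b := by
      by_cases h : ∃ S ∈ l, i ∈ S
      · obtain ⟨S, hS, hi⟩ := h
        refine (Finset.card_le_card fun j hj => ?_).trans (hcard S hS)
        obtain rfl | ⟨S', hS', hi', hj'⟩ := (Finset.mem_filter.mp hj).2
        · exact hi
        · by_contra hne
          have hSS : S' ≠ S := by rintro rfl; exact hne hj'
          exact Finset.disjoint_left.mp
            (hl.forall hS' hS hSS) hi' hi
      · refine (Finset.card_le_card (t := {i}) fun j hj => ?_).trans (by simpa using hb)
        obtain rfl | ⟨S', hS', hi', -⟩ := (Finset.mem_filter.mp hj).2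
        · simp
        · exact absurd ⟨S', hS', hi'⟩ h
    have hcard' : (T.biUnion g).card ≤ k * b :=
      (Finset.card_biUnion_le_card_mul _ _ _ fun i _ => hg i).trans (Nat.mul_le_mul_right _ hT)
    have hTg : T ⊆ T.biUnion g := fun i hi =>
      Finset.mem_biUnion.mpr ⟨i, hi, by simp [g]⟩
    rw [prod_czGate_filter (fun S => decide (¬ Disjoint S T)) l]
    set P := ((l.filter fun S => decide (¬ Disjoint S T)).map czGate).prod with hP
    set Q := ((l.filter fun S => !decide (¬ Disjoint S T)).map czGate).prod with hQ
    have hQA : Commute Q (tensorOp A) := by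
      refine Commute.list_prod_left _ _ fun X hX => ?_
      obtain ⟨S, hS, rfl⟩ := List.mem_map.mp hX
      refine commute_czGate_tensorOp (T := T) ?_ hA
      simpa using (List.mem_filter.mp hS).2
    have hQQ : Q * Q.conjTranspose = 1 := Unitary.mul_star_self_of_mem (prod_czGate_mem_unitary _)
    have hPm : P ∈ supportedOn (T.biUnion g) := by
      have aux (l' : List (Finset (Fin N))) (h : ∀ S ∈ l', S ⊆ T.biUnion g) :
          (l'.map czGate).prod ∈ supportedOn (T.biUnion g) := by
        induction l' with
        | nil => exact one_mem_supportedOn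
        | cons S l' ih =>
          rw [List.map_cons, List.prod_cons]
          exact mul_mem_supportedOn (czGate_mem_supportedOn (h S (by simp)))
            (ih fun S' hS' => h S' (by simp [hS']))
      refine aux _ fun S hS j hj => ?_
      obtain ⟨hS1, hS2⟩ := List.mem_filter.mp hS
      obtain ⟨i, hi, hiT⟩ := Finset.not_disjoint_iff.mp (of_decide_eq_true hS2)
      exact Finset.mem_biUnion.mpr ⟨i, hiT, by simp [g]; exact Or.inr ⟨S, hS1, hi, hj⟩⟩
    have heq : P * Q * tensorOp A * (P * Q).conjTranspose = P * tensorOp A * P.conjTranspose := by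
      rw [Matrix.conjTranspose_mul, mul_assoc P Q, hQA.eq]
      calc P * (tensorOp A * Q) * (Q.conjTranspose * P.conjTranspose)
          = P * tensorOp A * (Q * Q.conjTranspose) * P.conjTranspose := by simp only [mul_assoc]
        _ = _ := by rw [hQQ, mul_one]
    rw [heq]
    exact supportedOn_le_lowDegree hcard' (mul_mem_supportedOn (mul_mem_supportedOn hPm
      (tensorOp_mem_supportedOn fun i hi => hA i fun h => hi (hTg h)))
      (conjTranspose_mem_supportedOn hPm))
  | zero => simp
  | add X Y _ _ hX hY => rw [mul_add, add_mul]; exact add_mem hX hY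
  | smul c X _ hX => rw [mul_smul_comm, smul_mul_assoc]; exact Submodule.smul_mem _ _ hX

lemma sum_card_le_of_pairwise_disjoint {N : ℕ} {l : List (Finset (Fin N))}
    (hl : l.Pairwise Disjoint) : (l.map Finset.card).sum ≤ N := by
  suffices h : ∃ V : Finset (Fin N), V.card = (l.map Finset.card).sum ∧
      ∀ i ∈ V, ∃ S ∈ l, i ∈ S by
    obtain ⟨V, hV, -⟩ := h
    rw [← hV]
    simpa using Finset.card_le_univ V
  induction l with
  | nil => exact ⟨∅, by simp⟩
  | cons S l ih =>
    obtain ⟨h1, h2⟩ := List.pairwise_cons.mp hl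
    obtain ⟨V, hV, h3⟩ := ih h2
    refine ⟨S ∪ V, ?_, fun i hi => ?_⟩
    · rw [Finset.card_union_of_disjoint, hV, List.map_cons, List.sum_cons]
      refine Finset.disjoint_left.mpr fun i hi hiV => ?_
      obtain ⟨S', hS', hi'⟩ := h3 i hiV
      exact Finset.disjoint_left.mp (h1 S' hS') hi hi'
    · rcases Finset.mem_union.mp hi with hi | hi
      · exact ⟨S, by simp, hi⟩
      · obtain ⟨S', hS', hi'⟩ := h3 i hi
        exact ⟨S', by simp [hS'], hi'⟩

lemma norm_mul_sub_mul_le {N : ℕ} {A B A' B' : Op N} (hB : ‖B‖ ≤ 1) (hA' : ‖A'‖ ≤ 1) :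
    ‖A * B - A' * B'‖ ≤ ‖A - A'‖ + ‖B - B'‖ := by
  have h : A * B - A' * B' = (A - A') * B + A' * (B - B') := by noncomm_ring
  rw [h]
  refine (norm_add_le _ _).trans (add_le_add ?_ ?_)
  · exact (norm_mul_le _ _).trans (mul_le_of_le_one_right (norm_nonneg _) hB)
  · exact (norm_mul_le _ _).trans (mul_le_of_le_one_left (norm_nonneg _) hA')

lemma norm_mul_le_one {N : ℕ} {A B : Op N} (hA : ‖A‖ ≤ 1) (hB : ‖B‖ ≤ 1) : ‖A * B‖ ≤ 1 :=
  (norm_mul_le _ _).trans (mul_le_one₀ hA (norm_nonneg _) hB)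

/-- A gate on `S` costs degree at most `4s √|S|`, which is at most `4s |S| / √b` because `|S| > b`.
The cost becomes linear in `|S|`, so it can be summed over disjoint gates. The number of gates in
the error is crudely bounded by the total size. -/
lemma exists_approx_big_gates {N b : ℕ} (hb : 1 ≤ b) (s : ℕ) (l : List (Finset (Fin N)))
    (hbig : ∀ S ∈ l, b < S.card) :
    ∃ (k : ℕ) (G : Op N), G ∈ lowDegree N k ∧ ‖G‖ ≤ 1 ∧
      ‖(l.map czGate).prod - G‖ ≤ 2 * ((4 : ℝ) ^ s)⁻¹ * (l.map Finset.card).sum ∧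
      (k : ℝ) ≤ 4 * s * (l.map Finset.card).sum / √b := by
  have hb' : 0 < √(b : ℝ) := Real.sqrt_pos.mpr (by exact_mod_cast hb)
  induction l with
  | nil =>
    exact ⟨0, 1, one_mem_lowDegree, norm_le_one_of_mem_unitary (one_mem _), by simp, by simp⟩
  | cons S l ih =>
    obtain ⟨k, G, hG, hG1, herr, hk⟩ := ih fun T hT => hbig T (by simp [hT])
    have hS : b < S.card := hbig S (by simp)
    have hSpos : 0 < S.card := by omega
    obtain ⟨H, hH, hH1, herr'⟩ := exists_approx_czGate (Finset.card_pos.mp hSpos) s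
    refine ⟨_, H * G, mul_mem_lowDegree hH hG, norm_mul_le_one hH1 hG1, ?_, ?_⟩
    · rw [List.map_cons, List.prod_cons, List.map_cons, List.sum_cons]
      refine (norm_mul_sub_mul_le
        (norm_le_one_of_mem_unitary (prod_czGate_mem_unitary l)) hH1).trans ?_
      have h1 : (1 : ℝ) ≤ S.card := by exact_mod_cast hSpos
      have h2 : 0 ≤ 2 * ((4 : ℝ) ^ s)⁻¹ := by positivity
      rw [Nat.cast_add]
      nlinarith
    · rw [List.map_cons, List.sum_cons]
      rw [Nat.cast_add, Nat.cast_add, mul_add (4 * (s : ℝ)), add_div]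
      push_cast
      refine add_le_add ?_ (by simpa using hk)
      have h1 : ((S.card.sqrt : ℕ) : ℝ) ≤ √S.card := Real.nat_sqrt_le_real_sqrt
      have h2 : 1 ≤ √(S.card : ℝ) := Real.one_le_sqrt.mpr (by exact_mod_cast hSpos)
      have h3 : √(b : ℝ) ≤ √S.card := Real.sqrt_le_sqrt (by exact_mod_cast hS.le)
      have h4 : √(S.card : ℝ) * √S.card = S.card := Real.mul_self_sqrt (by positivity)
      rw [le_div_iff₀ hb']
      calc 2 * (s : ℝ) * (S.card.sqrt + 1) * √b ≤ 2 * s * (2 * √S.card) * √S.card := by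
            gcongr
            linarith
        _ = 4 * s * (√S.card * √S.card) := by ring
        _ = _ := by rw [h4]

lemma norm_conj_le_one {N : ℕ} {P Y : Op N} (hP : ‖P‖ ≤ 1) (hY : ‖Y‖ ≤ 1) :
    ‖P * Y * P.conjTranspose‖ ≤ 1 :=
  norm_mul_le_one (norm_mul_le_one hP hY) ((Matrix.l2_opNorm_conjTranspose P).trans_le hP)

lemma norm_conj_sub_conj_le {N : ℕ} {P G Y : Op N} (hP : ‖P‖ ≤ 1) (hG : ‖G‖ ≤ 1) (hY : ‖Y‖ ≤ 1) :
    ‖P * Y * P.conjTranspose - G * Y * G.conjTranspose‖ ≤ 2 * ‖P - G‖ := by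
  have h1 := norm_mul_sub_mul_le (A := P) (B' := Y) hY hG
  rw [sub_self, norm_zero, add_zero] at h1
  have h2 := norm_mul_sub_mul_le (A := P * Y) (A' := G * Y) (B' := G.conjTranspose)
    ((Matrix.l2_opNorm_conjTranspose P).trans_le hP) (norm_mul_le_one hG hY)
  rw [← Matrix.conjTranspose_sub, Matrix.l2_opNorm_conjTranspose] at h2
  linarith

/-- Diagonal gates commute, so the layer is `P * Q` with the large gates in `P`. Conjugation by `Q`
is exact and `P` is replaced on both sides, which doubles its error and degree. -/
lemma exists_approx_layer_conj {N b k : ℕ} (hb : 1 ≤ b) (s : ℕ) (M : CZLayer N) {B : Op N}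
    (hB : B ∈ lowDegree N k) (hB1 : ‖B‖ ≤ 1) :
    ∃ (k' : ℕ) (B' : Op N), B' ∈ lowDegree N k' ∧ ‖B'‖ ≤ 1 ∧
      ‖M.toOp * B * M.toOp.conjTranspose - B'‖ ≤ 4 * N * ((4 : ℝ) ^ s)⁻¹ ∧
      (k' : ℝ) ≤ k * b + 8 * s * N / √b := by
  have hsub : (M.gates.filter fun S => decide (b < S.card)).Sublist M.gates := List.filter_sublist
  obtain ⟨r, G, hG, hG1, herr, hr⟩ := exists_approx_big_gates hb s
    (M.gates.filter fun S => decide (b < S.card)) fun S hS => by simpa using (List.mem_filter.mp hS).2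
  have hsum : (((M.gates.filter fun S => decide (b < S.card)).map Finset.card).sum : ℝ) ≤ N := by
    exact_mod_cast sum_card_le_of_pairwise_disjoint (M.disjoint.sublist hsub)
  have hsmall := small_conj_mem_lowDegree hb
    (l := M.gates.filter fun S => !decide (b < S.card)) (M.disjoint.sublist List.filter_sublist)
    (fun S hS => by simpa using (List.mem_filter.mp hS).2) hB
  rw [CZLayer.toOp, prod_czGate_filter (fun S => decide (b < S.card)) M.gates]
  have hPu := prod_czGate_mem_unitary (M.gates.filter fun S => decide (b < S.card))
  have hQu := prod_czGate_mem_unitary (M.gates.filter fun S => !decide (b < S.card))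
  generalize ((M.gates.filter fun S => decide (b < S.card)).map czGate).prod = P at *
  generalize ((M.gates.filter fun S => !decide (b < S.card)).map czGate).prod = Q at *
  have hP1 := norm_le_one_of_mem_unitary hPu
  have hY1 := norm_conj_le_one (norm_le_one_of_mem_unitary hQu) hB1
  have hPG : ‖P - G‖ ≤ 2 * ((4 : ℝ) ^ s)⁻¹ * N :=
    herr.trans (mul_le_mul_of_nonneg_left hsum (by positivity))
  refine ⟨_, G * (Q * B * Q.conjTranspose) * G.conjTranspose,
    mul_mem_lowDegree (mul_mem_lowDegree hG hsmall) (conjTranspose_mem_lowDegree hG),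
    norm_conj_le_one hG1 hY1, ?_, ?_⟩
  · have heq : P * Q * B * (P * Q).conjTranspose =
        P * (Q * B * Q.conjTranspose) * P.conjTranspose := by
      simp only [Matrix.conjTranspose_mul, mul_assoc]
    rw [heq]
    refine (norm_conj_sub_conj_le hP1 hG1 hY1).trans ?_
    linarith
  · have h1 : 4 * s * (((M.gates.filter fun S => decide (b < S.card)).map Finset.card).sum : ℝ)
        / √b ≤ 4 * s * N / √b := by gcongr
    have h2 : 8 * s * N / √(b : ℝ) = 2 * (4 * s * N / √b) := by ring
    rw [Nat.cast_add, Nat.cast_add, Nat.cast_mul]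
    linarith

/-! ### Low-degree approximation of the state prepared by a circuit -/

lemma CZLayer.toOp_mem_unitary {N : ℕ} (M : CZLayer N) : M.toOp ∈ unitary (Op N) :=
  prod_czGate_mem_unitary M.gates

lemma QACCircuit.toOp_mem_unitary {N d : ℕ} (U : QACCircuit N d) : U.toOp ∈ unitary (Op N) := by
  induction U with
  | base L => exact L.toOp_mem_unitary
  | step C M L ih => exact mul_mem (mul_mem L.toOp_mem_unitary M.toOp_mem_unitary) ih

lemma le_of_rpow_le_four {N : ℕ} (hN : 1 ≤ N) {θ : ℝ} (hθ : 0 < θ) (h : (N : ℝ) ^ θ ≤ 4) :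
    (N : ℝ) ≤ 4 * (N : ℝ) ^ (1 - θ / 2) := by
  have hN' : (1 : ℝ) ≤ N := by exact_mod_cast hN
  calc (N : ℝ) = (N : ℝ) ^ (θ / 2) * (N : ℝ) ^ (1 - θ / 2) := by
        rw [← Real.rpow_add (by linarith), add_sub_cancel, Real.rpow_one]
    _ ≤ 4 * _ := by
        gcongr
        exact (Real.rpow_le_rpow_of_exponent_le hN' (by linarith)).trans h

/-- With `b ≈ N ^ θ / 4`, each of the two terms is at most `16 s N ^ (1 - θ/2)`, so the constant 32
reproduces itself from layer to layer. The hypothesis `N ^ θ > 4` absorbs the rounding: `b ≤ N ^ θ /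
2`. -/
lemma layer_degree_le {N b k s : ℕ} (hN : 1 ≤ N) {θ : ℝ} (h : 4 < (N : ℝ) ^ θ)
    (hb : b = ⌈(N : ℝ) ^ θ / 4⌉₊) (hk : (k : ℝ) ≤ 32 * s * (N : ℝ) ^ (1 - 3 * θ / 2)) :
    k * b + 8 * s * N / √b ≤ 32 * s * (N : ℝ) ^ (1 - θ / 2) := by
  have hN' : (0 : ℝ) < N := by exact_mod_cast hN
  have hb1 : (b : ℝ) ≤ (N : ℝ) ^ θ / 2 := by
    rw [hb]
    have := (Nat.ceil_lt_add_one (a := (N : ℝ) ^ θ / 4) (by positivity)).le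
    linarith
  have hb2 : (N : ℝ) ^ (θ / 2) / 2 ≤ √b := by
    refine Real.le_sqrt_of_sq_le ?_
    rw [div_pow, ← Real.rpow_natCast, ← Real.rpow_mul hN'.le]
    rw [show θ / 2 * ((2 : ℕ) : ℝ) = θ by push_cast; ring, hb]
    exact le_trans (by norm_num) (Nat.le_ceil _)
  have h1 : (N : ℝ) ^ (1 - 3 * θ / 2) * (N : ℝ) ^ θ = (N : ℝ) ^ (1 - θ / 2) := by
    rw [← Real.rpow_add hN']; congr 1; ring
  have h2 : (N : ℝ) / (N : ℝ) ^ (θ / 2) = (N : ℝ) ^ (1 - θ / 2) := by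
    rw [Real.rpow_sub hN', Real.rpow_one]
  have h3 : k * (b : ℝ) ≤ 16 * s * (N : ℝ) ^ (1 - θ / 2) := by
    calc k * (b : ℝ) ≤ 32 * s * (N : ℝ) ^ (1 - 3 * θ / 2) * ((N : ℝ) ^ θ / 2) := by gcongr
      _ = 16 * s * ((N : ℝ) ^ (1 - 3 * θ / 2) * (N : ℝ) ^ θ) := by ring
      _ = _ := by rw [h1]
  have h4 : 8 * s * N / √(b : ℝ) ≤ 16 * s * (N : ℝ) ^ (1 - θ / 2) := by
    calc 8 * s * N / √(b : ℝ) ≤ 8 * s * N / ((N : ℝ) ^ (θ / 2) / 2) := by gcongr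
      _ = 16 * s * (N / (N : ℝ) ^ (θ / 2)) := by rw [div_div_eq_mul_div]; ring
      _ = _ := by rw [h2]
  linarith

lemma exists_approx_circuit {N s d : ℕ} (hN : 1 ≤ N) (hs : 1 ≤ s) (U : QACCircuit N d) :
    ∃ (k : ℕ) (B : Op N), B ∈ lowDegree N k ∧ ‖B‖ ≤ 1 ∧
      ‖U.toOp * ketbra (basisKet fun _ => 0) * U.toOp.conjTranspose - B‖ ≤
        (4 * d * N + 1) * ((4 : ℝ) ^ s)⁻¹ ∧
      (k : ℝ) ≤ 32 * s * (N : ℝ) ^ (1 - ((3 : ℝ) ^ d)⁻¹ / 2) := by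
  have hconj {V X Y : Op N} (hV : ‖V‖ ≤ 1) :
      ‖V * X * V.conjTranspose - V * Y * V.conjTranspose‖ ≤ ‖X - Y‖ := by
    have h : V * X * V.conjTranspose - V * Y * V.conjTranspose =
        V * (X - Y) * V.conjTranspose := by noncomm_ring
    rw [h]
    refine (norm_mul_le _ _).trans ((mul_le_of_le_one_right (norm_nonneg _) ?_).trans
      ((norm_mul_le _ _).trans (mul_le_of_le_one_left (norm_nonneg _) hV)))
    exact (Matrix.l2_opNorm_conjTranspose V).trans_le hV
  have hN' : (1 : ℝ) ≤ N := by exact_mod_cast hN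
  have hs' : (1 : ℝ) ≤ s := by exact_mod_cast hs
  induction U with
  | base L =>
    obtain ⟨B, hB, hB1, herr⟩ := exists_approx_ketbra_zero hN s
    have hL := norm_le_one_of_mem_unitary L.toOp_mem_unitary
    refine ⟨_, _, local_conj_mem_lowDegree L hB, norm_conj_le_one hL hB1,
      (hconj hL).trans (by simpa using herr), ?_⟩
    have h1 : ((N.sqrt : ℕ) : ℝ) ≤ √N := Real.nat_sqrt_le_real_sqrt
    have h2 : 1 ≤ √(N : ℝ) := Real.one_le_sqrt.mpr hN'
    rw [show (1 : ℝ) - ((3 : ℝ) ^ 0)⁻¹ / 2 = 1 / 2 by norm_num, ← Real.sqrt_eq_rpow]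
    push_cast
    calc 2 * (s : ℝ) * (N.sqrt + 1) ≤ 2 * s * (16 * √N) := by gcongr; linarith
      _ = _ := by ring
  | @step d C M L ih =>
    obtain ⟨k, B, hB, hB1, herr, hk⟩ := ih
    set X := C.toOp * ketbra (basisKet fun _ => 0) * C.toOp.conjTranspose with hX
    have hL := norm_le_one_of_mem_unitary L.toOp_mem_unitary
    have hM := norm_le_one_of_mem_unitary M.toOp_mem_unitary
    have heq : (QACCircuit.step C M L).toOp * ketbra (basisKet fun _ => 0) *
        (QACCircuit.step C M L).toOp.conjTranspose =
        L.toOp * (M.toOp * X * M.toOp.conjTranspose) * L.toOp.conjTranspose := by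
      simp only [QACCircuit.toOp, Matrix.conjTranspose_mul, hX, mul_assoc]
    rw [heq]
    have hstep : ‖M.toOp * X * M.toOp.conjTranspose - M.toOp * B * M.toOp.conjTranspose‖ ≤
      (4 * d * N + 1) * ((4 : ℝ) ^ s)⁻¹ := (hconj hM).trans herr
    set θ : ℝ := ((3 : ℝ) ^ (d + 1))⁻¹ with hθ
    have hθ0 : 0 < θ := by positivity
    have h3θ : ((3 : ℝ) ^ d)⁻¹ = 3 * θ := by rw [hθ, pow_succ]; field_simp
    rw [h3θ] at hk
    -- If `N ^ θ ≤ 4`, the target degree already exceeds `N` and the layer is applied exactly.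
    by_cases hsmall : (N : ℝ) ^ θ ≤ 4
    · refine ⟨N, L.toOp * (M.toOp * B * M.toOp.conjTranspose) * L.toOp.conjTranspose,
        lowDegree_self _, norm_conj_le_one hL (norm_conj_le_one hM hB1),
        (hconj hL).trans (hstep.trans ?_), ?_⟩
      · push_cast
        gcongr
        linarith
      · refine (le_of_rpow_le_four hN hθ0 hsmall).trans ?_
        gcongr
        linarith
    · push Not at hsmall
      have hb : 1 ≤ ⌈(N : ℝ) ^ θ / 4⌉₊ := Nat.one_le_ceil_iff.mpr (by linarith)
      obtain ⟨k', B', hB', hB1', herr', hk'⟩ := exists_approx_layer_conj hb s M hB hB1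
      refine ⟨k', L.toOp * B' * L.toOp.conjTranspose, local_conj_mem_lowDegree L hB',
        norm_conj_le_one hL hB1', (hconj hL).trans ?_, hk'.trans (layer_degree_le hN hsmall rfl hk)⟩
      calc _ ≤ _ := norm_sub_le_norm_sub_add_norm_sub _ (M.toOp * B * M.toOp.conjTranspose) _
        _ ≤ _ := add_le_add hstep herr'
        _ = _ := by push_cast; ring

/-! ### Compression along an ancilla state -/

/-- The isometry `|x⟩ ↦ |x⟩ ⊗ |η⟩`. -/
def appendKet (n : ℕ) {a : ℕ} (η : Ket a) : Matrix (Bits (n + a)) (Bits n) ℂ :=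
  Matrix.of fun x y =>
    if (fun i => x (Fin.castAdd a i)) = y then η (fun j => x (Fin.natAdd n j)) else 0

lemma sum_bits_add {n a : ℕ} (f : Bits (n + a) → ℂ) :
    ∑ x, f x = ∑ y : Bits n, ∑ z : Bits a, f (Fin.append y z) := by
  rw [← (Fin.appendEquiv n a).sum_comp, Fintype.sum_prod_type]
  rfl

lemma appendKet_append {n a : ℕ} (η : Ket a) (x y : Bits n) (z : Bits a) :
    appendKet n η (Fin.append x z) y = if x = y then η z else 0 := by
  simp [appendKet]

lemma appendKet_isometry {n a : ℕ} {η : Ket a} (hη : IsPure η) :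
    (appendKet n η).conjTranspose * appendKet n η = 1 := by
  ext x y
  rw [Matrix.mul_apply, sum_bits_add, Matrix.one_apply]
  simp only [Matrix.conjTranspose_apply, appendKet_append]
  rw [Finset.sum_eq_single x (fun w _ hw => by simp [hw]) (by simp)]
  by_cases h : x = y
  · subst h
    simpa [IsPure, dotProduct] using hη
  · simp [h]

lemma norm_appendKet_le {n a : ℕ} {η : Ket a} (hη : IsPure η) : ‖appendKet n η‖ ≤ 1 := by
  have h := Matrix.l2_opNorm_conjTranspose_mul_self (appendKet n η)
  rw [appendKet_isometry hη, norm_one] at h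
  nlinarith [norm_nonneg (appendKet n η)]

/-- On a product operator, compression replaces the ancilla factors by a scalar, their expectation
in `η`, and leaves the first `n` factors alone. -/
lemma compress_mem_lowDegree {n a k : ℕ} (η : Ket a) {X : Op (n + a)}
    (hX : X ∈ lowDegree (n + a) k) :
    (appendKet n η).conjTranspose * X * appendKet n η ∈ lowDegree n k := by
  classical
  induction hX using Submodule.span_induction with
  | mem X h =>
    obtain ⟨T, A, hT, hA, rfl⟩ := h
    have heq : (appendKet n η).conjTranspose * tensorOp A * appendKet n η =
        (∑ z : Bits a, ∑ z' : Bits a,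
          star (η z) * (∏ j, A (Fin.natAdd n j) (z j) (z' j)) * η z') •
        tensorOp fun i => A (Fin.castAdd a i) := by
      ext x y
      simp only [Matrix.mul_apply, sum_bits_add, Matrix.conjTranspose_apply, appendKet_append,
        tensorOp, Matrix.of_apply, Fin.prod_univ_add, Fin.append_left, Fin.append_right,
        Matrix.smul_apply, smul_eq_mul]
      rw [Finset.sum_eq_single y (fun w _ hw => by simp [hw]) (by simp)]
      simp only [if_true, Finset.sum_mul]
      rw [Finset.sum_comm]
      rw [Finset.sum_eq_single x (fun w _ hw => by simp [hw]) (by simp)]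
      rw [Finset.sum_comm]
      refine Finset.sum_congr rfl fun z _ => Finset.sum_congr rfl fun z' _ => ?_
      rw [if_pos rfl]
      ring
    rw [heq]
    refine Submodule.smul_mem _ _ (tensorOp_mem_lowDegree
      (Finset.univ.filter fun i => Fin.castAdd a i ∈ T) (le_trans ?_ hT) fun i hi => hA _ ?_)
    · exact Finset.card_le_card_of_injOn (Fin.castAdd a) (fun i hi => by simpa using hi)
        (Fin.castAdd_injective n a).injOn
    · simpa using hi
  | zero => simp
  | add X Y _ _ hX hY => rw [Matrix.mul_add, Matrix.add_mul]; exact add_mem hX hY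
  | smul c X _ hX => rw [Matrix.mul_smul, Matrix.smul_mul]; exact Submodule.smul_mem _ _ hX

lemma conj_ketbra {ι κ : Type*} [Fintype ι] [Fintype κ] (W : Matrix κ ι ℂ) (ψ : ι → ℂ) :
    W * Matrix.vecMulVec ψ (star ψ) * W.conjTranspose =
      Matrix.vecMulVec (W.mulVec ψ) (star (W.mulVec ψ)) := by
  rw [Matrix.mul_vecMulVec, Matrix.vecMulVec_mul, Matrix.star_mulVec]

/-! ### Euclidean norms -/

lemma star_dotProduct_eq_inner {ι : Type*} [Fintype ι] (u v : ι → ℂ) :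
    dotProduct (star u) v = inner ℂ (WithLp.toLp 2 u) (WithLp.toLp 2 v) := by
  rw [EuclideanSpace.inner_toLp_toLp, dotProduct_comm]

lemma norm_toLp_sq {ι : Type*} [Fintype ι] (u : ι → ℂ) :
    ((‖WithLp.toLp 2 u‖ ^ 2 : ℝ) : ℂ) = dotProduct (star u) u := by
  rw [star_dotProduct_eq_inner, inner_self_eq_norm_sq_to_K]
  norm_cast

lemma IsPure.norm_toLp {n : ℕ} {ψ : Ket n} (h : IsPure ψ) : ‖WithLp.toLp 2 ψ‖ = 1 := by
  have h1 := norm_toLp_sq ψ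
  rw [h] at h1
  have h2 : ‖WithLp.toLp 2 ψ‖ ^ 2 = 1 := by exact_mod_cast h1
  exact (pow_eq_one_iff_of_nonneg (norm_nonneg _) two_ne_zero).mp h2

lemma norm_star_dotProduct_mulVec_le {n : ℕ} (X : Op n) (u v : Ket n) :
    ‖dotProduct (star u) (X.mulVec v)‖ ≤ ‖WithLp.toLp 2 u‖ * (‖X‖ * ‖WithLp.toLp 2 v‖) := by
  rw [star_dotProduct_eq_inner]
  refine (norm_inner_le_norm _ _).trans (mul_le_mul_of_nonneg_left ?_ (norm_nonneg _))
  exact Matrix.l2_opNorm_mulVec X (WithLp.toLp 2 v)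

lemma norm_vecMulVec_star_le {n : ℕ} (u v : Ket n) :
    ‖(Matrix.vecMulVec u (star v) : Op n)‖ ≤ ‖WithLp.toLp 2 u‖ * ‖WithLp.toLp 2 v‖ := by
  rw [Matrix.cstar_norm_def]
  refine ContinuousLinearMap.opNorm_le_bound _ (by positivity) fun x => ?_
  have h : Matrix.toEuclideanCLM (n := Bits n) (𝕜 := ℂ) (Matrix.vecMulVec u (star v)) x =
      (inner ℂ (WithLp.toLp 2 v) x : ℂ) • WithLp.toLp 2 u := by
    ext i
    rw [Matrix.ofLp_toEuclideanCLM, Matrix.vecMulVec_mulVec, star_dotProduct_eq_inner]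
    simp [mul_comm]
  rw [h, norm_smul]
  have := norm_inner_le_norm (𝕜 := ℂ) (WithLp.toLp 2 v) x
  nlinarith [norm_nonneg (WithLp.toLp 2 u)]

lemma norm_ketbra_sub_ketbra_le {n : ℕ} {φ v : Ket n} (hφ : IsPure φ)
    (hv : ‖WithLp.toLp 2 v‖ ≤ 1) :
    ‖ketbra φ - ketbra v‖ ≤ 2 * ‖WithLp.toLp 2 φ - WithLp.toLp 2 v‖ := by
  have h : ketbra φ - ketbra v =
      Matrix.vecMulVec (φ - v) (star φ) + Matrix.vecMulVec v (star (φ - v)) := by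
    rw [star_sub, Matrix.sub_vecMulVec, Matrix.vecMulVec_sub, ketbra, ketbra]
    abel
  have h1 := norm_vecMulVec_star_le (φ - v) φ
  have h2 := norm_vecMulVec_star_le v (φ - v)
  rw [hφ.norm_toLp, WithLp.toLp_sub] at h1
  rw [WithLp.toLp_sub] at h2
  rw [h]
  refine (norm_add_le _ _).trans ?_
  nlinarith [norm_nonneg (WithLp.toLp 2 φ - WithLp.toLp 2 v)]

lemma norm_toLp_sub_le {n : ℕ} {φ v : Ket n} {δ : ℝ} (hφ : IsPure φ)
    (hv : ‖WithLp.toLp 2 v‖ ≤ 1) (h : 1 - δ ≤ (dotProduct (star φ) v).re) :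
    ‖WithLp.toLp 2 φ - WithLp.toLp 2 v‖ ≤ √(2 * δ) := by
  refine Real.le_sqrt_of_sq_le ?_
  rw [norm_sub_sq (𝕜 := ℂ), hφ.norm_toLp, ← star_dotProduct_eq_inner]
  have h1 : ‖WithLp.toLp 2 v‖ ^ 2 ≤ 1 := pow_le_one₀ (norm_nonneg _) hv
  have h2 : RCLike.re (dotProduct (star φ) v) = (dotProduct (star φ) v).re := rfl
  rw [h2]
  linarith

/-- Uhlmann's theorem for a pure target: with `w` the partial inner product of `φ` with `ψ`, the
fidelity is `‖w‖`, and `η = w / ‖w‖` attains it. If `w = 0`, any `η` works. -/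
lemma exists_ancilla_overlap {n a : ℕ} (φ : Ket n) (ψ : Ket (n + a)) :
    ∃ η : Ket a, IsPure η ∧ dotProduct (star φ) ((appendKet n η).conjTranspose.mulVec ψ) =
      (pureFidelity φ (partialTrace (ketbra ψ)) : ℂ) := by
  set w : Ket a := fun z => ∑ x : Bits n, star (φ x) * ψ (Fin.append x z) with hw
  have hfid : pureFidelity φ (partialTrace (ketbra ψ)) = ‖WithLp.toLp 2 w‖ := by
    have h : dotProduct (star φ) ((partialTrace (ketbra ψ)).mulVec φ) =
        dotProduct (star w) w := by
      simp only [dotProduct, Matrix.mulVec, partialTrace, ketbra, Matrix.of_apply,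
        Matrix.vecMulVec_apply, Pi.star_apply, hw, star_sum, star_mul', star_star,
        Finset.mul_sum, Finset.sum_mul]
      rw [Finset.sum_comm]
      rw [Finset.sum_congr rfl fun x _ => Finset.sum_comm]
      rw [Finset.sum_comm]
      refine Finset.sum_congr rfl fun z _ => ?_
      rw [Finset.sum_comm]
      refine Finset.sum_congr rfl fun x _ => Finset.sum_congr rfl fun y _ => ?_
      ring
    rw [pureFidelity, h, ← norm_toLp_sq, Complex.ofReal_re, Real.sqrt_sq (norm_nonneg _)]
  have hdot (η : Ket a) : dotProduct (star φ) ((appendKet n η).conjTranspose.mulVec ψ) =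
      dotProduct (star η) w := by
    simp only [dotProduct, Matrix.mulVec, Matrix.conjTranspose_apply, Pi.star_apply, hw,
      sum_bits_add, appendKet_append, Finset.mul_sum]
    rw [Finset.sum_comm (s := Finset.univ (α := Bits a))]
    refine Finset.sum_congr rfl fun x _ => ?_
    rw [Finset.sum_eq_single x (fun y _ hy => by simp [hy]) (by simp)]
    refine Finset.sum_congr rfl fun z _ => ?_
    rw [if_pos rfl]
    ring
  rw [hfid]
  by_cases h0 : ‖WithLp.toLp 2 w‖ = 0
  · refine ⟨basisKet 0, ?_, ?_⟩
    · simp [IsPure, dotProduct, basisKet]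
    · have : w = 0 := by simpa using h0
      rw [hdot, h0, this, dotProduct_zero, Complex.ofReal_zero]
  · have h0' : (‖WithLp.toLp 2 w‖ : ℂ) ≠ 0 := by exact_mod_cast h0
    refine ⟨(‖WithLp.toLp 2 w‖ : ℂ)⁻¹ • w, ?_, ?_⟩
    · rw [IsPure, star_smul, smul_dotProduct, dotProduct_smul, ← norm_toLp_sq]
      simp only [star_inv₀, Complex.star_def, Complex.conj_ofReal, smul_eq_mul, Complex.ofReal_pow]
      field_simp
    · rw [hdot, star_smul, smul_dotProduct, ← norm_toLp_sq]
      simp only [star_inv₀, Complex.star_def, Complex.conj_ofReal, smul_eq_mul, Complex.ofReal_pow]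
      field_simp

lemma norm_toLp_mulVec_le {ι κ : Type*} [Fintype ι] [DecidableEq ι] [Fintype κ]
    {X : Matrix κ ι ℂ} {v : ι → ℂ} (hX : ‖X‖ ≤ 1) (hv : ‖WithLp.toLp 2 v‖ ≤ 1) :
    ‖WithLp.toLp 2 (X.mulVec v)‖ ≤ 1 :=
  (Matrix.l2_opNorm_mulVec X (WithLp.toLp 2 v)).trans (mul_le_one₀ hX (norm_nonneg _) hv)

lemma isPure_basisKet {n : ℕ} (x : Bits n) : IsPure (basisKet x) := by
  simp [IsPure, dotProduct, basisKet]

theorem exists_approx_of_synthesizes {n a d s : ℕ} (hn : 1 ≤ n + a) (hs : 1 ≤ s) {φ : Ket n}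
    (hφ : IsPure φ) {U : QACCircuit (n + a) d} {δ : ℝ} (hU : Synthesizes U φ δ) :
    ∃ (k : ℕ) (B : Op n), B ∈ lowDegree n k ∧
      ‖ketbra φ - B‖ ≤ 2 * √(2 * δ) + (4 * d * (n + a : ℕ) + 1) * ((4 : ℝ) ^ s)⁻¹ ∧
      (k : ℝ) ≤ 32 * s * ((n + a : ℕ) : ℝ) ^ (1 - ((3 : ℝ) ^ d)⁻¹ / 2) := by
  obtain ⟨k, B, hB, -, herr, hk⟩ := exists_approx_circuit hn hs U
  have hψ : U.toOp * ketbra (basisKet fun _ => 0) * U.toOp.conjTranspose =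
      ketbra (U.toOp.mulVec (basisKet fun _ => 0)) := conj_ketbra _ _
  rw [Synthesizes, hψ] at hU
  rw [hψ] at herr
  have hψ1 := norm_toLp_mulVec_le (norm_le_one_of_mem_unitary U.toOp_mem_unitary)
    (isPure_basisKet (n := n + a) fun _ => 0).norm_toLp.le
  generalize U.toOp.mulVec (basisKet fun _ => 0) = ψ at *
  obtain ⟨η, hη, hov⟩ := exists_ancilla_overlap φ ψ
  have hW := norm_appendKet_le (n := n) hη
  have hW' : ‖(appendKet n η).conjTranspose‖ ≤ 1 :=
    (Matrix.l2_opNorm_conjTranspose (appendKet n η)).trans_le hW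
  have hv := norm_toLp_mulVec_le hW' hψ1
  refine ⟨k, _, compress_mem_lowDegree η hB, ?_, hk⟩
  -- The compressed vector has norm at most 1 and real overlap at least `1 - δ` with `φ`, hence lies
  -- within `√(2δ)` of it.
  have h1 : ‖ketbra φ - ketbra ((appendKet n η).conjTranspose.mulVec ψ)‖ ≤ 2 * √(2 * δ) :=
    (norm_ketbra_sub_ketbra_le hφ hv).trans (mul_le_mul_of_nonneg_left
      (norm_toLp_sub_le hφ hv (by rw [hov, Complex.ofReal_re]; exact hU)) zero_le_two)
  have h2 : ketbra ((appendKet n η).conjTranspose.mulVec ψ) -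
      (appendKet n η).conjTranspose * B * appendKet n η =
      (appendKet n η).conjTranspose * (ketbra ψ - B) * appendKet n η := by
    have h := conj_ketbra (appendKet n η).conjTranspose ψ
    rw [Matrix.conjTranspose_conjTranspose] at h
    rw [Matrix.mul_sub, Matrix.sub_mul, ketbra, ← h, ketbra]
  have h3 : ‖(appendKet n η).conjTranspose * (ketbra ψ - B) * appendKet n η‖ ≤
      ‖ketbra ψ - B‖ :=
    (Matrix.l2_opNorm_mul _ _).trans ((mul_le_of_le_one_right (norm_nonneg _) hW).trans
      ((Matrix.l2_opNorm_mul _ _).trans (mul_le_of_le_one_left (norm_nonneg _) hW')))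
  rw [← h2] at h3
  exact (norm_sub_le_norm_sub_add_norm_sub _ _ _).trans (add_le_add h1 (h3.trans herr))

/-! ### The approximate degree of nekomata states -/

lemma star_tensorKet_dotProduct {n m : ℕ} (u u' : Ket n) (v v' : Ket m) :
    dotProduct (star (tensorKet u v)) (tensorKet u' v') =
      dotProduct (star u) u' * dotProduct (star v) v' := by
  simp only [dotProduct, Pi.star_apply, tensorKet, sum_bits_add, Fin.append_left, Fin.append_right,
    Finset.sum_mul_sum, star_mul']
  refine Finset.sum_congr rfl fun x _ => Finset.sum_congr rfl fun y _ => ?_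
  ring

lemma nekomata_overlaps {n m : ℕ} (hn : 1 ≤ n) {ψ₀ ψ₁ : Ket m} (h₀ : IsPure ψ₀) (h₁ : IsPure ψ₁) :
    let u := tensorKet (basisKet (fun _ : Fin n => 0)) ψ₀
    let v := tensorKet (basisKet (fun _ : Fin n => 1)) ψ₁
    IsPure u ∧ IsPure v ∧ dotProduct (star u) v = 0 ∧ dotProduct (star v) u = 0 := by
  have hne : (fun _ : Fin n => (0 : Fin 2)) ≠ fun _ => 1 := fun h =>
    zero_ne_one (congrFun h ⟨0, hn⟩)
  simp only [IsPure, star_tensorKet_dotProduct] at *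
  rw [h₀, h₁]
  refine ⟨?_, ?_, ?_, ?_⟩ <;> simp [dotProduct, basisKet, hne, hne.symm]

lemma sqrt_two_inv_mul_self : ((Real.sqrt 2 : ℂ)⁻¹) * (Real.sqrt 2 : ℂ)⁻¹ = 1 / 2 := by
  rw [← mul_inv, ← Complex.ofReal_mul, Real.mul_self_sqrt zero_le_two]
  norm_num

lemma IsNekomata.isPure {n m : ℕ} (hn : 1 ≤ n) {ν : Ket (n + m)} (hν : IsNekomata n m ν) :
    IsPure ν := by
  obtain ⟨ψ₀, ψ₁, h₀, h₁, rfl⟩ := hν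
  obtain ⟨h1, h2, h3, h4⟩ := nekomata_overlaps hn h₀ h₁
  rw [IsPure] at *
  rw [star_smul, smul_dotProduct, dotProduct_smul, smul_smul, star_add, add_dotProduct,
    dotProduct_add, dotProduct_add, h1, h2, h3, h4, Complex.star_def, map_inv₀,
    Complex.conj_ofReal, sqrt_two_inv_mul_self]
  norm_num

/-- A product operator supported on fewer than `n` qubits acts as the identity on one of the first
`n`, where it contributes the factor `⟨0|1⟩ = 0`. -/
lemma dotProduct_mulVec_eq_zero_of_mem_lowDegree {n m k : ℕ} (hk : k < n) (ψ₀ ψ₁ : Ket m)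
    {B : Op (n + m)} (hB : B ∈ lowDegree (n + m) k) :
    dotProduct (star (tensorKet (basisKet (fun _ : Fin n => 0)) ψ₀))
      (B.mulVec (tensorKet (basisKet (fun _ : Fin n => 1)) ψ₁)) = 0 := by
  induction hB using Submodule.span_induction with
  | mem X h =>
    obtain ⟨T, A, hT, hA, rfl⟩ := h
    obtain ⟨i, hi⟩ : ∃ i : Fin n, Fin.castAdd m i ∉ T := by
      by_contra! hall
      have := Finset.card_le_card_of_injOn (s := Finset.univ) (Fin.castAdd m)
        (fun i _ => hall i) (Fin.castAdd_injective n m).injOn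
      rw [Finset.card_univ, Fintype.card_fin] at this
      omega
    refine Finset.sum_eq_zero fun x _ => ?_
    rw [Matrix.mulVec, dotProduct, Finset.mul_sum]
    refine Finset.sum_eq_zero fun y _ => ?_
    simp only [Pi.star_apply, tensorKet, basisKet, tensorOp, Matrix.of_apply]
    by_cases hx : x (Fin.castAdd m i) = 0
    · by_cases hy : y (Fin.castAdd m i) = 1
      · have hz : ∏ j, A j (x j) (y j) = 0 := by
          refine Finset.prod_eq_zero (Finset.mem_univ (Fin.castAdd m i)) ?_
          rw [hA _ hi, hx, hy]
          simp
        rw [hz]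
        ring
      · rw [if_neg (c := (fun j => y (Fin.castAdd m j)) = fun _ => 1) fun h => hy (congrFun h i)]
        ring
    · rw [if_neg fun h => hx (congrFun h i)]
      simp
  | zero => simp
  | add X Y _ _ hX hY => rw [Matrix.add_mulVec, dotProduct_add, hX, hY, add_zero]
  | smul c X _ hX => rw [Matrix.smul_mulVec, dotProduct_smul, hX, smul_zero]

lemma star_dotProduct_ketbra_mulVec {n : ℕ} (ψ u v : Ket n) :
    dotProduct (star u) ((ketbra ψ).mulVec v) =
      dotProduct (star ψ) v * dotProduct (star u) ψ := by
  rw [ketbra, Matrix.vecMulVec_mulVec, op_smul_eq_smul, dotProduct_smul, smul_eq_mul]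

lemma half_le_norm_ketbra_sub {n : ℕ} {u v : Ket n} (hu : IsPure u) (hv : IsPure v)
    (huv : dotProduct (star u) v = 0) {B : Op n} (hB : dotProduct (star u) (B.mulVec v) = 0) :
    1 / 2 ≤ ‖ketbra (((Real.sqrt 2 : ℂ)⁻¹) • (u + v)) - B‖ := by
  have h := norm_star_dotProduct_mulVec_le (ketbra (((Real.sqrt 2 : ℂ)⁻¹) • (u + v)) - B) u v
  rw [hu.norm_toLp, hv.norm_toLp, one_mul, mul_one, Matrix.sub_mulVec, dotProduct_sub, hB,
    sub_zero, star_dotProduct_ketbra_mulVec] at h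
  rw [IsPure] at hu hv
  rw [star_smul, smul_dotProduct, dotProduct_smul, star_add, add_dotProduct, dotProduct_add,
    hu, hv, huv, Complex.star_def, map_inv₀, Complex.conj_ofReal, zero_add, add_zero, smul_eq_mul,
    mul_one, sqrt_two_inv_mul_self] at h
  simpa using h

lemma half_le_norm_nekomata_sub {n m k : ℕ} (hk : k < n) {ν : Ket (n + m)}
    (hν : IsNekomata n m ν) {B : Op (n + m)} (hB : B ∈ lowDegree (n + m) k) :
    1 / 2 ≤ ‖ketbra ν - B‖ := by
  obtain ⟨ψ₀, ψ₁, h₀, h₁, rfl⟩ := hν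
  obtain ⟨h1, h2, h3, -⟩ := nekomata_overlaps (by omega : 1 ≤ n) h₀ h₁
  exact half_le_norm_ketbra_sub h1 h2 h3
    (dotProduct_mulVec_eq_zero_of_mem_lowDegree hk ψ₀ ψ₁ hB)

lemma isNekomata_catKet (n : ℕ) : IsNekomata n 0 (catKet n) := by
  have h : IsPure (fun _ => 1 : Ket 0) := by simp [IsPure, dotProduct]
  refine ⟨_, _, h, h, ?_⟩
  rw [catKet]
  congr 1
  ext x
  simp only [Pi.add_apply, tensorKet, mul_one]
  rfl

/-! ### Size bounds -/

/-- Trades the logarithm of `N` for that of `x`. If `x ≤ √N` the bound holds outright, as the right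
side is at least `√N`; otherwise `log N ≤ 2 log (x + 2)`. -/
lemma le_mul_of_le_log_mul {N : ℕ} (hN : 1 ≤ N) {θ x : ℝ} (hθ : θ ≤ 1) (hx : 0 ≤ x)
    (h : x ≤ 32 * (Nat.clog 2 N + 1 : ℕ) * (N : ℝ) ^ (1 - θ / 2)) :
    1 / 200 * x / Real.log (x + 2) ^ 1 ≤ (N : ℝ) ^ (1 - θ / 2) := by
  have hN' : (1 : ℝ) ≤ N := by exact_mod_cast hN
  have hlog2 : 0.69 < Real.log 2 := by linarith [Real.log_two_gt_d9]
  have hL : Real.log 2 ≤ Real.log (x + 2) := Real.log_le_log (by norm_num) (by linarith)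
  rw [pow_one, div_le_iff₀ (by linarith)]
  have hP : √(N : ℝ) ≤ (N : ℝ) ^ (1 - θ / 2) := by
    rw [Real.sqrt_eq_rpow]
    exact Real.rpow_le_rpow_of_exponent_le hN' (by linarith)
  set P := (N : ℝ) ^ (1 - θ / 2)
  have hP0 : 0 ≤ P := (Real.sqrt_nonneg _).trans hP
  by_cases hxN : x ≤ √(N : ℝ)
  · nlinarith
  · push Not at hxN
    have h1 : Real.log N ≤ 2 * Real.log (x + 2) := by
      have h2 : Real.log √(N : ℝ) ≤ Real.log (x + 2) :=
        Real.log_le_log (Real.sqrt_pos.mpr (by linarith)) (by linarith)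
      rw [Real.log_sqrt (by linarith)] at h2
      linarith
    have h3 : ((Nat.clog 2 N : ℕ) : ℝ) ≤ 2.9 * Real.log (x + 2) + 1 := by
      have h4 := Real.natCeil_logb_natCast 2 N
      push_cast at h4
      rw [← h4]
      have h5 : Real.logb 2 N ≤ 2.9 * Real.log (x + 2) := by
        rw [Real.logb, div_le_iff₀ (by linarith)]
        nlinarith
      have h6 := Nat.ceil_lt_add_one (Real.logb_nonneg one_lt_two hN')
      linarith
    push_cast at h
    have h7 : ((Nat.clog 2 N : ℕ) : ℝ) + 1 ≤ 5.8 * Real.log (x + 2) := by nlinarith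
    have h8 := mul_le_mul_of_nonneg_right h7 hP0
    nlinarith

lemma inv_four_pow_le {N : ℕ} (hN : 1 ≤ N) :
    ((4 : ℝ) ^ (Nat.clog 2 N + 1))⁻¹ ≤ ((N : ℝ) ^ 2)⁻¹ := by
  have hN' : (0 : ℝ) < N := by exact_mod_cast hN
  have h : (N : ℝ) ≤ 2 ^ (Nat.clog 2 N + 1) := by
    have h1 : N ≤ 2 ^ (Nat.clog 2 N + 1) :=
      (Nat.le_pow_clog one_lt_two N).trans (Nat.pow_le_pow_right two_pos (Nat.le_succ _))
    exact_mod_cast h1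
  refine inv_anti₀ (by positivity) ((pow_le_pow_left₀ hN'.le h 2).trans_eq ?_)
  rw [← pow_mul, mul_comm, pow_mul]
  norm_num

lemma circuit_error_le {N : ℕ} (hN : 1 ≤ N) (d : ℕ) :
    (4 * d * (N : ℝ) + 1) * ((4 : ℝ) ^ (Nat.clog 2 N + 1))⁻¹ ≤ (4 * d + 1) / N := by
  have hN' : (1 : ℝ) ≤ N := by exact_mod_cast hN
  calc _ ≤ (4 * d * (N : ℝ) + 1) * ((N : ℝ) ^ 2)⁻¹ := by
        gcongr ?_ * ?_
        exact inv_four_pow_le hN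
    _ ≤ _ := by
        rw [← div_eq_mul_inv, div_le_div_iff₀ (by positivity) (by positivity)]
        nlinarith

lemma inv_three_pow_le_one (d : ℕ) : ((3 : ℝ) ^ d)⁻¹ ≤ 1 :=
  inv_le_one_of_one_le₀ (one_le_pow₀ (by norm_num))

lemma two_mul_sqrt_le {δ : ℝ} (h0 : 0 ≤ δ) (h1 : δ ≤ 1) :
    2 * √(2 * δ) ≤ 10 * δ ^ (1 / 4 : ℝ) := by
  have h2 : √(2 * δ) = √2 * √δ := Real.sqrt_mul zero_le_two δ
  have h3 : √(2 : ℝ) ≤ 2 := Real.sqrt_le_iff.mpr (by norm_num)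
  have h4 : √δ ≤ δ ^ (1 / 4 : ℝ) := by
    rw [Real.sqrt_eq_rpow]
    exact Real.rpow_le_rpow_of_exponent_ge_of_imp h0 h1 (by norm_num) (by norm_num)
  have h5 : √2 * √δ ≤ 2 * √δ := mul_le_mul_of_nonneg_right h3 (Real.sqrt_nonneg _)
  have h6 : 0 ≤ √δ := Real.sqrt_nonneg _
  rw [h2]
  linarith

theorem approxDegree_bound {n a d : ℕ} (hn : 1 ≤ n) (hd : 1 ≤ d) {φ : Ket n} (hφ : IsPure φ)
    {U : QACCircuit (n + a) d} {δ : ℝ} (hδ : 0 ≤ δ) (hU : Synthesizes U φ δ) {ε : ℝ}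
    (hε : 10 * δ ^ (1 / 4 : ℝ) + 5 * ((d : ℝ) / (n : ℝ)) ≤ ε) :
    1 / 200 * (approxDegree ε (ketbra φ) : ℝ) / Real.log ((approxDegree ε (ketbra φ) : ℝ) + 2) ^ 1
      ≤ ((n : ℝ) + (a : ℝ)) ^ (1 - ((3 : ℝ) ^ d)⁻¹ / 2) := by
  have hN : 1 ≤ n + a := by omega
  have hd' : (1 : ℝ) ≤ d := by exact_mod_cast hd
  have hn' : (1 : ℝ) ≤ n := by exact_mod_cast hn
  rw [← Nat.cast_add]
  refine le_mul_of_le_log_mul hN (inv_three_pow_le_one d) (by positivity) ?_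
  -- For `δ > 1` the tolerance exceeds `‖ketbra φ‖ ≤ 1`, so the zero operator shows that the
  -- approximate degree is 0.
  by_cases h1 : δ ≤ 1
  · obtain ⟨k, B, hB, herr, hk⟩ :=
      exists_approx_of_synthesizes hN (Nat.le_add_left 1 (Nat.clog 2 (n + a))) hφ hU
    refine le_trans ?_ hk
    have h2 := circuit_error_le hN d
    -- The constant `C = 5` comes from `4d + 1 ≤ 5d`, which needs `d ≥ 1`.
    have h3 : (4 * d + 1) / ((n + a : ℕ) : ℝ) ≤ 5 * ((d : ℝ) / n) := by
      rw [← mul_div_assoc]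
      push_cast
      gcongr ?_ / ?_
      · linarith
      · linarith [Nat.cast_nonneg (α := ℝ) a]
    have h4 := two_mul_sqrt_le hδ h1
    exact_mod_cast approxDegree_le_of_mem_lowDegree (by linarith) hB
  · push Not at h1
    have h2 : 1 ≤ δ ^ (1 / 4 : ℝ) := Real.one_le_rpow h1.le (by norm_num)
    have h3 : ‖ketbra φ - 0‖ ≤ ε := by
      have h4 := norm_vecMulVec_star_le φ φ
      rw [hφ.norm_toLp] at h4
      have h5 : 0 ≤ 5 * ((d : ℝ) / n) := by positivity
      rw [sub_zero, ketbra]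
      linarith
    have h4 := approxDegree_le_of_mem_lowDegree h3 (zero_mem (lowDegree n 0))
    rw [Nat.le_zero.mp h4, Nat.cast_zero]
    positivity

theorem nekomata_bound {n m a d : ℕ} (hn : 1 ≤ n) {ν : Ket (n + m)} (hν : IsNekomata n m ν)
    {U : QACCircuit (n + m + a) d} {δ : ℝ} (hδ : δ < 1 / 10240000) (hU : Synthesizes U ν δ) :
    1 / 200 * (n : ℝ) / Real.log ((n : ℝ) + 2) ^ 1
      ≤ ((n : ℝ) + (m : ℝ) + (a : ℝ)) ^ (1 - ((3 : ℝ) ^ d)⁻¹ / 2) := by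
  have hN : 1 ≤ n + m + a := by omega
  rw [← Nat.cast_add, ← Nat.cast_add]
  refine le_mul_of_le_log_mul hN (inv_three_pow_le_one d) (by positivity) ?_
  obtain ⟨k, B, hB, herr, hk⟩ := exists_approx_of_synthesizes hN
    (Nat.le_add_left 1 (Nat.clog 2 (n + m + a))) (hν.isPure hn) hU
  by_cases hkn : n ≤ k
  · exact le_trans (by exact_mod_cast hkn) hk
  · have h1 := half_le_norm_nekomata_sub (not_le.mp hkn) hν hB
    have h2 := circuit_error_le hN d
    have h3 : √(2 * δ) ≤ 1 / 2000 := Real.sqrt_le_iff.mpr ⟨by norm_num, by norm_num; linarith⟩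
    have hN' : (0 : ℝ) < (n + m + a : ℕ) := by exact_mod_cast hN
    -- The fidelity loss uses at most `0.001` of the distance `1/2`, so an approximant of degree
    -- below `n` forces the circuit error to be large. Then `N = O(d)`, hence `N ≤ 4 ^ (3 ^ d)`, and
    -- the claim holds for trivial reasons.
    have h4 : (0.499 : ℝ) ≤ (4 * d + 1) / (n + m + a : ℕ) := by linarith
    rw [le_div_iff₀ hN'] at h4
    have h5 : ((n + m + a : ℕ) : ℝ) ≤ 4 ^ (3 ^ d) := by
      have h6 : (1 : ℝ) + d * 2 ≤ (1 + 2) ^ d := one_add_mul_le_pow (by norm_num) d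
      have h7 : 2 * d + 1 ≤ 3 ^ d := by
        have h : ((2 * d + 1 : ℕ) : ℝ) ≤ ((3 ^ d : ℕ) : ℝ) := by
          push_cast; norm_num at h6; linarith
        exact_mod_cast h
      have h8 : (1 : ℝ) + d * 15 ≤ (1 + 15) ^ d := one_add_mul_le_pow (by norm_num) d
      calc ((n + m + a : ℕ) : ℝ) ≤ 4 * (1 + d * 15) := by
            linarith [Nat.cast_nonneg (α := ℝ) d]
        _ ≤ 4 * (1 + 15) ^ d := by linarith
        _ = 4 ^ (2 * d + 1) := by rw [pow_succ, pow_mul]; norm_num; ring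
        _ ≤ _ := pow_le_pow_right₀ (by norm_num) h7
    have h9 : ((n + m + a : ℕ) : ℝ) ^ ((3 : ℝ) ^ d)⁻¹ ≤ 4 := by
      rw [Real.rpow_inv_le_iff_of_pos hN'.le (by norm_num) (by positivity)]
      exact_mod_cast h5
    calc (n : ℝ) ≤ (n + m + a : ℕ) := by exact_mod_cast (by omega : n ≤ n + m + a)
      _ ≤ 4 * _ := le_of_rpow_le_four hN (by positivity) h9
      _ ≤ _ := by
        gcongr
        push_cast
        linarith [Nat.cast_nonneg (α := ℝ) (Nat.clog 2 (n + m + a))]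

lemma not_forall_div_log_le {A β : ℝ} (hA : 1 ≤ A) (hβ : 0 < β) :
    ¬ ∀ n : ℕ, 1 ≤ n → 1 / 200 * (n : ℝ) / Real.log ((n : ℝ) + 2) ^ 1 ≤ (A * n) ^ (1 - β) := by
  intro h
  have hlim : Filter.Tendsto (fun n : ℕ => (n : ℝ) ^ (β / 2)) Filter.atTop Filter.atTop :=
    (tendsto_rpow_atTop (by positivity)).comp tendsto_natCast_atTop_atTop
  -- Bounding `log (n + 2)` by a multiple of `n ^ (β/2)` leaves a spare factor `n ^ (β/2)`; `n` is
  -- chosen so that this factor beats all the constants.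
  obtain ⟨n, hn1, hn2⟩ := ((Filter.eventually_ge_atTop 1).and
    (hlim.eventually_gt_atTop (200 * A * (3 ^ (β / 2) / (β / 2))))).exists
  have hn : (1 : ℝ) ≤ n := by exact_mod_cast hn1
  have hn0 : (0 : ℝ) < n := by linarith
  have h1 := h n hn1
  have hlog : 0 < Real.log ((n : ℝ) + 2) := Real.log_pos (by linarith)
  rw [pow_one, div_le_iff₀ hlog] at h1
  have h2 : (A * n) ^ (1 - β) ≤ A * (n : ℝ) ^ (1 - β) := by
    rw [Real.mul_rpow (by linarith) hn0.le]
    gcongr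
    calc A ^ (1 - β) ≤ A ^ (1 : ℝ) := Real.rpow_le_rpow_of_exponent_le hA (by linarith)
      _ = A := Real.rpow_one A
  have h3 : Real.log ((n : ℝ) + 2) ≤ 3 ^ (β / 2) / (β / 2) * (n : ℝ) ^ (β / 2) := by
    calc Real.log ((n : ℝ) + 2) ≤ Real.log (3 * n) := Real.log_le_log (by linarith) (by linarith)
      _ ≤ (3 * n) ^ (β / 2) / (β / 2) := Real.log_le_rpow_div (by linarith) (by positivity)
      _ = _ := by rw [Real.mul_rpow (by norm_num) hn0.le]; ring
  have h4 : (n : ℝ) ^ (1 - β) * ((n : ℝ) ^ (β / 2) * (n : ℝ) ^ (β / 2)) = n := by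
    rw [← Real.rpow_add hn0, ← Real.rpow_add hn0, show 1 - β + (β / 2 + β / 2) = 1 by ring,
      Real.rpow_one]
  have h5 : (n : ℝ) ≤ 200 * (A * (n : ℝ) ^ (1 - β) *
      (3 ^ (β / 2) / (β / 2) * (n : ℝ) ^ (β / 2))) := by
    have := mul_le_mul h2 h3 hlog.le (by positivity)
    linarith
  have h6 : 0 < (n : ℝ) ^ (1 - β) * (n : ℝ) ^ (β / 2) := by positivity
  have h7 := mul_lt_mul_of_pos_left hn2 h6
  linarith

theorem nekomata_notMem_stateQLC0 {δ : ℝ} (hδ : δ < 1 / 10240000) (m : ℕ → ℕ)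
    (ν : (n : ℕ) → Ket (n + m n)) (hν : ∀ n, 1 ≤ n → IsNekomata n (m n) (ν n)) :
    ν ∉ stateQLC0 (fun n => n + m n) δ := by
  rintro ⟨D, A, h⟩
  have hA : (1 : ℝ) ≤ A := by
    obtain ⟨d, a, -, ha, -⟩ := h 1 le_rfl
    have ha : 1 + m 1 + a ≤ A * 1 := ha
    have : 1 ≤ A := by omega
    exact_mod_cast this
  refine not_forall_div_log_le hA (β := ((3 : ℝ) ^ D)⁻¹ / 2) (by positivity) fun n hn => ?_
  obtain ⟨d, a, hd, ha, U, hU⟩ := h n hn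
  refine (nekomata_bound hn (hν n hn) hδ hU).trans ?_
  have hn' : (1 : ℝ) ≤ n := by exact_mod_cast hn
  have ha' : (n : ℝ) + m n + a ≤ A * n := by exact_mod_cast ha
  -- The depth may vary with `n`; the weakest exponent, at the maximal depth `D`, serves for all.
  have hmono : ((3 : ℝ) ^ D)⁻¹ ≤ ((3 : ℝ) ^ d)⁻¹ :=
    inv_anti₀ (by positivity) (pow_le_pow_right₀ (by norm_num) hd)
  have hone := inv_three_pow_le_one d
  calc _ ≤ (A * n : ℝ) ^ (1 - ((3 : ℝ) ^ d)⁻¹ / 2) := by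
        refine Real.rpow_le_rpow (by positivity) ha' (by linarith)
    _ ≤ _ := Real.rpow_le_rpow_of_exponent_le (by nlinarith) (by linarith)

theorem mainTheorem7 :
    -- the general bound, with absolute constants
    (∃ (C c : ℝ) (k : ℕ), 0 < C ∧ 0 < c ∧
      ∀ (n a d : ℕ), 1 ≤ n → 1 ≤ d →
      ∀ (φ : Ket n), IsPure φ →
      ∀ (U : QACCircuit (n + a) d) (δ : ℝ), 0 ≤ δ → Synthesizes U φ δ →
      ∀ ε : ℝ, 10 * δ ^ (1 / 4 : ℝ) + C * ((d : ℝ) / (n : ℝ)) ≤ ε →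
        c * (approxDegree ε (ketbra φ) : ℝ) /
            Real.log ((approxDegree ε (ketbra φ) : ℝ) + 2) ^ k
          ≤ ((n : ℝ) + (a : ℝ)) ^ (1 - ((3 : ℝ) ^ d)⁻¹ / 2)) ∧
    -- nekomata states, on `n + m` qubits, and cat states
    (∃ (c : ℝ) (k : ℕ), 0 < c ∧
      (∀ (n m a d : ℕ), 1 ≤ n →
        ∀ (ν : Ket (n + m)), IsNekomata n m ν →
        ∀ (U : QACCircuit (n + m + a) d) (δ : ℝ), 0 ≤ δ → δ < 1 / 10240000 →
          Synthesizes U ν δ →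
          c * (n : ℝ) / Real.log ((n : ℝ) + 2) ^ k
            ≤ ((n : ℝ) + (m : ℝ) + (a : ℝ)) ^ (1 - ((3 : ℝ) ^ d)⁻¹ / 2)) ∧
      (∀ (n a d : ℕ), 1 ≤ n →
        ∀ (U : QACCircuit (n + a) d) (δ : ℝ), 0 ≤ δ → δ < 1 / 10240000 →
          Synthesizes U (catKet n) δ →
          c * (n : ℝ) / Real.log ((n : ℝ) + 2) ^ k
            ≤ ((n : ℝ) + (a : ℝ)) ^ (1 - ((3 : ℝ) ^ d)⁻¹ / 2))) ∧
    -- consequently they do not belong to the class of linear-ancilla synthesizable families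
    (∀ (δ : ℝ), 0 ≤ δ → δ < 1 / 10240000 →
      (∀ (m : ℕ → ℕ) (ν : (n : ℕ) → Ket (n + m n)), (∀ n : ℕ, 1 ≤ n → IsNekomata n (m n) (ν n)) →
        ν ∉ stateQLC0 (fun n => n + m n) δ) ∧
      (fun n => catKet n) ∉ stateQLC0 (fun n => n) δ) := by
  refine ⟨⟨5, 1 / 200, 1, by norm_num, by norm_num, fun n a d hn hd φ hφ U δ hδ hU ε hε =>
    approxDegree_bound hn hd hφ hδ hU hε⟩, ⟨1 / 200, 1, by norm_num, ?_, ?_⟩, ?_⟩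
  · exact fun n m a d hn ν hν U δ _ hδ hU => nekomata_bound hn hν hδ hU
  · intro n a d hn U δ _ hδ hU
    have h := nekomata_bound (m := 0) hn (isNekomata_catKet n) hδ hU
    rwa [Nat.cast_zero, add_zero] at h
  · exact fun δ _ hδ => ⟨fun m ν hν => nekomata_notMem_stateQLC0 hδ m ν hν,
      nekomata_notMem_stateQLC0 hδ (fun _ => 0) (fun n => catKet n) fun n _ => isNekomata_catKet n⟩
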